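/- Let $X=\theta+E\in\mathbb R^{p\times n}$, where the entries of $E$ are independent standard Gaussians and $\theta=(\theta_{ji})$ is an unknown mean matrix. Let $\Theta_0(p,n)$ be the set of matrices $\theta\in\mathbb R^{p\times n}$ all of whose rows are constant. For $\rho\ge 0$ and $s\in\mathbb N$, let $\Theta_1(p,n,\rho,s)$ be the set of $\theta\in\mathbb R^{p\times n}$ for which there are a set of rows $S\subseteq\{1,\dots,p\}$ with $|S|\ge s$, a changepoint $t^*\in\{1,\dots,n-1\}$ and reals $\mu_{j1},\mu_{j2}$ ($1\le j\le p$) such that $\theta_{ji}=\mu_{j1}$ for $i\le t^*$ and $\theta_{ji}=\mu_{j2}$ for $i>t^*$, with $\sqrt{t^*(n-t^*)/n}\,(\mu_{j1}-\mu_{j2})\ge\rho$ for every $j\in S$ and $\mu_{j1}=\mu_{j2}$ for every $j\notin S$. The minimax testing error is $$\mathcal R(p,n,\rho,s)=\inf_{\psi}\Bigl[\sup_{\theta\in\Theta_0(p,n)}\mathbb E_\theta\,\psi(X)+\sup_{\theta\in\Theta_1(p,n,\rho,s)}\mathbb E_\theta\{1-\psi(X)\}\Bigr],$$ the infimum being over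 all Borel measurable $\psi:\mathbb R^{p\times n}\to\{0,1\}$. Theorem. Let $a>0$, $\beta\in(1/2,1]$, $r>0$ and $\rho=\rho_p=\sqrt{2r\log p}$. Let $n=n_p$ and $s=s_p$ be sequences of non-negative integers such that, as $p\to\infty$, $$\frac{\log\log n}{a\log p}\to 1,\qquad \frac{s}{p^{1-\beta}}\to 1 .$$ Put $$r_2^*(a,\beta)=\begin{cases}\beta-1/2, & 1/2<\beta\le 3/4,\\ (1-\sqrt{1-\beta})^2, & 3/4<\beta<1,\\ 1+a, & \beta=1.\end{cases}$$ 1. (Lower bound) If $r<r_2^*(a,\beta)$, then $\mathcal R(p,n,\rho,s)\not\to 0$ as $p\to\infty$. 2. (Upper bound) If $r>r_2^*(a,\beta)$, then $\mathcal R(p,n,\rho,s)\to 0$ as $p\to\infty$. -/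

import Mathlib

open MeasureTheory ProbabilityTheory Filter Topology

noncomputable section

namespace Changepoint

/-- The law `P_θ` of the observation `X = θ + E ∈ ℝ^{p × n}`, where the entries of `E` are
independent standard Gaussians: the entries of `X` are independent with `X j i ∼ N(θ j i, 1)`. -/
def law {p n : ℕ} (θ : Fin p → Fin n → ℝ) : Measure (Fin p → Fin n → ℝ) :=
  Measure.pi fun j => Measure.pi fun i => gaussianReal (θ j i) 1

/-- `Θ₀(p, n)`: the mean matrices all of whose rows are constant. -/
def nullSpace (p n : ℕ) : Set (Fin p → Fin n → ℝ) :=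
  {θ | ∃ μ : Fin p → ℝ, ∀ j i, θ j i = μ j}

/-- `Θ₁(p, n, ρ, s)`: the mean matrices with a common changepoint `t ∈ {1, …, n - 1}` at which
the rows in a set `S` of at least `s` rows have a decrease in mean of normalized size at least
`ρ`, the rows outside `S` being constant. Columns are indexed from `0` here, so that the first `t`
columns are those with index `i < t`. -/
def altSpace (p n : ℕ) (ρ : ℝ) (s : ℕ) : Set (Fin p → Fin n → ℝ) :=
  {θ | ∃ (S : Finset (Fin p)) (μ₁ μ₂ : Fin p → ℝ) (t : ℕ),
      s ≤ S.card ∧ 1 ≤ t ∧ t < n ∧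
      (∀ j ∈ S, ρ ≤ Real.sqrt ((t : ℝ) * ((n : ℝ) - (t : ℝ)) / (n : ℝ)) * (μ₁ j - μ₂ j)) ∧
      (∀ j ∉ S, μ₁ j = μ₂ j) ∧
      ∀ (j : Fin p) (i : Fin n), θ j i = if (i : ℕ) < t then μ₁ j else μ₂ j}

/-- Non-randomized tests: Borel measurable functions with values in `{0, 1}`. -/
def tests (p n : ℕ) : Set ((Fin p → Fin n → ℝ) → ℝ) :=
  {ψ | Measurable ψ ∧ ∀ x, ψ x = 0 ∨ ψ x = 1}

/-- The worst-case testing error of `ψ`: worst-case type I error plus worst-case type II error. -/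
def testingError (p n : ℕ) (ρ : ℝ) (s : ℕ) (ψ : (Fin p → Fin n → ℝ) → ℝ) : ℝ :=
  (⨆ θ : nullSpace p n, ∫ x, ψ x ∂(law θ.1)) +
    ⨆ θ : altSpace p n ρ s, ∫ x, (1 - ψ x) ∂(law θ.1)

/-- The minimax testing error: the infimum of the worst-case testing error over all tests. -/
def minimaxError (p n : ℕ) (ρ : ℝ) (s : ℕ) : ℝ :=
  ⨅ ψ : tests p n, testingError p n ρ s ψ.1

/-- The boundary `r₂*(a, β)`, for `a > 0` and `1/2 < β ≤ 1`. -/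
def boundary (a β : ℝ) : ℝ :=
  if β ≤ 3 / 4 then β - 1 / 2
  else if β < 1 then (1 - Real.sqrt (1 - β)) ^ 2
  else 1 + a

end Changepoint

end

noncomputable section

namespace Changepoint

/-! Signals and thresholds are measured in units of √(2 log p), so that every Gaussian tail becomes
a power of p and both halves of the theorem reduce to comparing exponents.

Lower bound (`le_minimaxError_of_mixture`, `le_minimaxError`). The zero mean is compared with a
uniform mixture of alternatives: one row out of each of s blocks of m = ⌊p/s⌋ rows, and one
changepoint among K = ⌊p^κ⌋ powers of p. If the mixture likelihood ratio has bounded second moment,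
no test has small error. Two different changepoints give almost orthogonal directions, and such
pairs contribute at most a constant near 1. Pairs with the same changepoint contribute at most (1 +
A/m)^s / K, where A is the factor per common row. The plain second moment would make A too large at
high signal; each likelihood ratio is therefore truncated to the event that its planted rows stay
below a threshold, and A is bounded by an exponential tilt (`integral_truncLR_mul_le_of_eq`). For β
< 1 a single changepoint already yields the boundary. For β = 1 the p^κ changepoints, with κ < a,
raise it to 1 + a.

Upper bound (`minimaxError_le_of_scan`). A grid of O(log n) changepoints, equally spaced in
log-odds, loses only a factor γ < 1 of the signal (`exists_grid_mean_le`). At each grid point the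
rows are projected on the unit contrast, and those above a threshold y are counted. For β < 1 the
planted rows add p^(1-β-(y-x)²) exceedances, up to small losses in the exponent, against a noise
level p^((1-y²)/2). Chernoff bounds make the errors stretched-exponentially small, so the union over
the grid, polynomial in p, costs nothing (`tendsto_minimaxError_of_exponents`). For β = 1 only one
planted row is guaranteed; a single exceedance rejects, and the union over p rows and about p^a grid
points forces y² > 1 + a (`tendsto_minimaxError_of_one`). -/

/-! ### Change of measure for Gaussian matrices -/

/-- A finite product of measures with densities has the product of the densities as density. -/
lemma pi_withDensity {ι : Type*} [Fintype ι] {α : ι → Type*} [∀ i, MeasurableSpace (α i)]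
    (μ : ∀ i, Measure (α i)) [∀ i, IsProbabilityMeasure (μ i)] (f : ∀ i, α i → ENNReal)
    (hf : ∀ i, Measurable (f i)) [∀ i, SigmaFinite ((μ i).withDensity (f i))] :
    Measure.pi (fun i => (μ i).withDensity (f i))
      = (Measure.pi μ).withDensity (fun x => ∏ i, f i (x i)) := by
  refine Measure.pi_eq fun s hs => ?_
  rw [withDensity_apply _ (MeasurableSet.univ_pi hs),
    ← lintegral_indicator (MeasurableSet.univ_pi hs)]
  have h1 : (Set.univ.pi s).indicator (fun x => ∏ i, f i (x i))
      = fun x => ∏ i, (s i).indicator (f i) (x i) := by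
    ext x
    by_cases hx : x ∈ Set.univ.pi s
    · rw [Set.indicator_of_mem hx]
      exact Finset.prod_congr rfl fun i _ => (Set.indicator_of_mem (hx i (Set.mem_univ i)) _).symm
    · rw [Set.indicator_of_notMem hx]
      simp only [Set.mem_pi, Set.mem_univ, true_implies, not_forall] at hx
      obtain ⟨i, hi⟩ := hx
      exact (Finset.prod_eq_zero (Finset.mem_univ i) (Set.indicator_of_notMem hi _)).symm
  have hm : ∀ i, Measurable ((s i).indicator (f i)) := fun i => (hf i).indicator (hs i)
  have h2 := lintegral_prod_eq_prod_lintegral_of_indepFun Finset.univ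
    (fun i (x : ∀ i, α i) => (s i).indicator (f i) (x i))
    (iIndepFun_pi (μ := μ) (fun i => (hm i).aemeasurable))
    (fun i => (hm i).comp (measurable_pi_apply i))
  rw [h1, h2]
  refine Finset.prod_congr rfl fun i _ => ?_
  rw [withDensity_apply _ (hs i), ← lintegral_indicator (hs i)]
  exact (measurePreserving_eval μ i).lintegral_comp (hm i)

instance {p n : ℕ} (θ : Fin p → Fin n → ℝ) : IsProbabilityMeasure (law θ) := by
  unfold law; infer_instance

/-- The Euclidean inner product of two `p × n` matrices. -/
def pair {p n : ℕ} (θ x : Fin p → Fin n → ℝ) : ℝ := ∑ j, ∑ i, θ j i * x j i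

lemma measurable_pair {p n : ℕ} (θ : Fin p → Fin n → ℝ) : Measurable (pair θ) := by
  unfold pair; fun_prop

lemma gaussianReal_eq_withDensity (m : ℝ) :
    gaussianReal m 1 = (gaussianReal 0 1).withDensity
      (fun x => ENNReal.ofReal (Real.exp (m * x - m ^ 2 / 2))) := by
  rw [gaussianReal_of_var_ne_zero _ one_ne_zero, gaussianReal_of_var_ne_zero _ one_ne_zero,
    ← withDensity_mul _ (measurable_gaussianPDF _ _) (by fun_prop)]
  congr 1
  ext x
  simp only [Pi.mul_apply, gaussianPDF, gaussianPDFReal]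
  rw [← ENNReal.ofReal_mul (by positivity), mul_assoc _⁻¹, ← Real.exp_add]
  congr 3
  simp only [NNReal.coe_one]
  ring

lemma law_eq_withDensity {p n : ℕ} (θ : Fin p → Fin n → ℝ) :
    law θ = (law (0 : Fin p → Fin n → ℝ)).withDensity
      (fun x => ENNReal.ofReal (Real.exp (pair θ x - pair θ θ / 2))) := by
  have hrow : ∀ j, Measure.pi (fun i => gaussianReal (θ j i) 1)
      = (Measure.pi fun _ : Fin n => gaussianReal 0 1).withDensity
        (fun x => ∏ i, ENNReal.ofReal (Real.exp (θ j i * x i - θ j i ^ 2 / 2))) := by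
    intro j
    have hs : ∀ i, SigmaFinite ((gaussianReal 0 1).withDensity
      (fun x => ENNReal.ofReal (Real.exp (θ j i * x - θ j i ^ 2 / 2)))) := by
      intro i; rw [← gaussianReal_eq_withDensity]; infer_instance
    rw [← pi_withDensity (fun _ : Fin n => gaussianReal 0 1)
      (fun i x => ENNReal.ofReal (Real.exp (θ j i * x - θ j i ^ 2 / 2))) (by intro i; fun_prop)]
    simp_rw [← gaussianReal_eq_withDensity]
  have hs : ∀ j, SigmaFinite ((Measure.pi fun _ : Fin n => gaussianReal 0 1).withDensity
      (fun x => ∏ i, ENNReal.ofReal (Real.exp (θ j i * x i - θ j i ^ 2 / 2)))) := by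
    intro j; rw [← hrow]; infer_instance
  unfold law
  simp_rw [hrow]
  rw [pi_withDensity (fun _ : Fin p => Measure.pi fun _ : Fin n => gaussianReal 0 1)
    (fun j x => ∏ i, ENNReal.ofReal (Real.exp (θ j i * x i - θ j i ^ 2 / 2)))
    (by intro j; fun_prop)]
  simp only [Pi.zero_apply]
  congr 1
  ext x
  simp_rw [← ENNReal.ofReal_prod_of_nonneg (fun _ _ => (Real.exp_pos _).le), ← Real.exp_sum]
  rw [← ENNReal.ofReal_prod_of_nonneg (fun _ _ => (Real.exp_pos _).le), ← Real.exp_sum]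
  congr 2
  unfold pair
  rw [Finset.sum_div, ← Finset.sum_sub_distrib]
  refine Finset.sum_congr rfl fun j _ => ?_
  rw [Finset.sum_div, ← Finset.sum_sub_distrib]
  exact Finset.sum_congr rfl fun i _ => by ring

lemma integral_law {p n : ℕ} (θ : Fin p → Fin n → ℝ) (f : (Fin p → Fin n → ℝ) → ℝ) :
    ∫ x, f x ∂(law θ)
      = ∫ x, Real.exp (pair θ x - pair θ θ / 2) * f x ∂(law (0 : Fin p → Fin n → ℝ)) := by
  have hm := measurable_pair θ
  rw [law_eq_withDensity, integral_withDensity_eq_integral_toReal_smul (by fun_prop)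
    (Eventually.of_forall fun _ => ENNReal.ofReal_lt_top)]
  simp only [ENNReal.toReal_ofReal (Real.exp_pos _).le, smul_eq_mul]

/-- The likelihood ratio has total mass one, which evaluates the Gaussian Laplace transform without
computing an integral. -/
lemma integral_exp_pair {p n : ℕ} (v : Fin p → Fin n → ℝ) :
    ∫ x, Real.exp (pair v x) ∂(law (0 : Fin p → Fin n → ℝ)) = Real.exp (pair v v / 2) := by
  have h := integral_law v (fun _ => 1)
  simp only [integral_const, probReal_univ, smul_eq_mul, mul_one, sub_eq_add_neg, Real.exp_add] at h
  rw [integral_mul_const, Real.exp_neg, ← div_eq_mul_inv, eq_div_iff (Real.exp_pos _).ne'] at h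
  linarith

/-- A non-integrable function would have Bochner integral 0, whereas the value just found is
positive. -/
lemma integrable_exp_pair {p n : ℕ} (v : Fin p → Fin n → ℝ) :
    Integrable (fun x => Real.exp (pair v x)) (law (0 : Fin p → Fin n → ℝ)) := by
  by_contra h
  exact (Real.exp_pos (pair v v / 2)).ne' ((integral_exp_pair v).symm.trans (integral_undef h))

/-! ### Tests and the minimax error -/

lemma integrable_test {p n : ℕ} {ψ : (Fin p → Fin n → ℝ) → ℝ} (hψ : ψ ∈ tests p n)
    (P : Measure (Fin p → Fin n → ℝ)) [IsProbabilityMeasure P] : Integrable ψ P :=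
  Integrable.of_bound hψ.1.aestronglyMeasurable 1 (Eventually.of_forall fun x => by
    rcases hψ.2 x with h | h <;> simp [h])

lemma compl_test {p n : ℕ} {ψ : (Fin p → Fin n → ℝ) → ℝ} (hψ : ψ ∈ tests p n) :
    (fun x => 1 - ψ x) ∈ tests p n :=
  ⟨hψ.1.const_sub 1, fun x => by rcases hψ.2 x with h | h <;> simp [h]⟩

lemma integral_test_nonneg {p n : ℕ} {ψ : (Fin p → Fin n → ℝ) → ℝ} (hψ : ψ ∈ tests p n)
    (P : Measure (Fin p → Fin n → ℝ)) : 0 ≤ ∫ x, ψ x ∂P :=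
  integral_nonneg fun x => by rcases hψ.2 x with h | h <;> simp [h]

lemma integral_test_le_one {p n : ℕ} {ψ : (Fin p → Fin n → ℝ) → ℝ} (hψ : ψ ∈ tests p n)
    (P : Measure (Fin p → Fin n → ℝ)) [IsProbabilityMeasure P] : ∫ x, ψ x ∂P ≤ 1 := by
  have h : ∫ x, ψ x ∂P ≤ ∫ _, (1 : ℝ) ∂P :=
    integral_mono (integrable_test hψ P) (integrable_const 1) fun x => by
      rcases hψ.2 x with h | h <;> simp [h]
  simpa using h

instance (p n : ℕ) : Nonempty (tests p n) :=
  ⟨⟨fun _ => 0, measurable_const, fun _ => Or.inl rfl⟩⟩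

lemma testingError_nonneg {p n : ℕ} (ρ : ℝ) (s : ℕ) {ψ : (Fin p → Fin n → ℝ) → ℝ}
    (hψ : ψ ∈ tests p n) : 0 ≤ testingError p n ρ s ψ :=
  add_nonneg (Real.iSup_nonneg fun _ => integral_test_nonneg hψ _)
    (Real.iSup_nonneg fun _ => integral_test_nonneg (compl_test hψ) _)

lemma minimaxError_nonneg (p n : ℕ) (ρ : ℝ) (s : ℕ) : 0 ≤ minimaxError p n ρ s :=
  Real.iInf_nonneg fun ψ => testingError_nonneg ρ s ψ.2

/-- The signs of `ε₁` and `ε₂` matter when a parameter space is empty, since the real supremum is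
then 0. -/
lemma minimaxError_le {p n : ℕ} {ρ : ℝ} {s : ℕ} {ψ : (Fin p → Fin n → ℝ) → ℝ}
    (hψ : ψ ∈ tests p n) {ε₁ ε₂ : ℝ} (h₁ : 0 ≤ ε₁) (h₂ : 0 ≤ ε₂)
    (hnull : ∀ θ ∈ nullSpace p n, ∫ x, ψ x ∂(law θ) ≤ ε₁)
    (halt : ∀ θ ∈ altSpace p n ρ s, ∫ x, (1 - ψ x) ∂(law θ) ≤ ε₂) :
    minimaxError p n ρ s ≤ ε₁ + ε₂ := by
  have hb : BddBelow (Set.range fun ψ : tests p n => testingError p n ρ s ψ.1) :=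
    ⟨0, by rintro _ ⟨φ, rfl⟩; exact testingError_nonneg ρ s φ.2⟩
  exact (ciInf_le hb ⟨ψ, hψ⟩).trans (add_le_add
    (Real.iSup_le (fun θ => hnull θ.1 θ.2) h₁) (Real.iSup_le (fun θ => halt θ.1 θ.2) h₂))

lemma le_testingError {p n : ℕ} {ρ : ℝ} {s : ℕ} {ψ : (Fin p → Fin n → ℝ) → ℝ}
    (hψ : ψ ∈ tests p n) {θ₀ θ₁ : Fin p → Fin n → ℝ} (h₀ : θ₀ ∈ nullSpace p n)
    (h₁ : θ₁ ∈ altSpace p n ρ s) :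
    ∫ x, ψ x ∂(law θ₀) + ∫ x, (1 - ψ x) ∂(law θ₁) ≤ testingError p n ρ s ψ := by
  refine add_le_add
    (le_ciSup (f := fun θ : nullSpace p n => ∫ x, ψ x ∂(law θ.1)) ⟨1, ?_⟩ ⟨θ₀, h₀⟩)
    (le_ciSup (f := fun θ : altSpace p n ρ s => ∫ x, (1 - ψ x) ∂(law θ.1)) ⟨1, ?_⟩ ⟨θ₁, h₁⟩)
  · rintro _ ⟨θ, rfl⟩; exact integral_test_le_one hψ _
  · rintro _ ⟨θ, rfl⟩; exact integral_test_le_one (compl_test hψ) _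

/-! ### Second moment method with truncated likelihood ratios -/

/-- The likelihood ratio of `law θ` against `law 0`, truncated to the event `D`. -/
def truncLR {p n : ℕ} (θ : Fin p → Fin n → ℝ) (D : Set (Fin p → Fin n → ℝ)) :
    (Fin p → Fin n → ℝ) → ℝ :=
  D.indicator fun x => Real.exp (pair θ x - pair θ θ / 2)

lemma truncLR_nonneg {p n : ℕ} (θ : Fin p → Fin n → ℝ) (D : Set (Fin p → Fin n → ℝ)) (x) :
    0 ≤ truncLR θ D x :=
  Set.indicator_nonneg (fun _ _ => (Real.exp_pos _).le) x

lemma truncLR_le {p n : ℕ} (θ : Fin p → Fin n → ℝ) (D : Set (Fin p → Fin n → ℝ)) (x) :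
    truncLR θ D x ≤ Real.exp (pair θ x - pair θ θ / 2) :=
  Set.indicator_le_self' (fun _ _ => (Real.exp_pos _).le) x

lemma measurable_truncLR {p n : ℕ} (θ : Fin p → Fin n → ℝ) {D : Set (Fin p → Fin n → ℝ)}
    (hD : MeasurableSet D) : Measurable (truncLR θ D) := by
  have := measurable_pair θ
  exact Measurable.indicator (by fun_prop) hD

lemma pair_add_left {p n : ℕ} (θ θ' x : Fin p → Fin n → ℝ) :
    pair (θ + θ') x = pair θ x + pair θ' x := by
  simp [pair, add_mul, Finset.sum_add_distrib]

lemma integrable_truncLR {p n : ℕ} (θ : Fin p → Fin n → ℝ) {D : Set (Fin p → Fin n → ℝ)}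
    (hD : MeasurableSet D) : Integrable (truncLR θ D) (law 0) := by
  refine ((integrable_exp_pair θ).mul_const (Real.exp (-(pair θ θ / 2)))).mono'
    (measurable_truncLR θ hD).aestronglyMeasurable (Eventually.of_forall fun x => ?_)
  rw [Real.norm_of_nonneg (truncLR_nonneg θ D x), ← Real.exp_add, ← sub_eq_add_neg]
  exact truncLR_le θ D x

lemma integrable_truncLR_mul {p n : ℕ} (θ θ' : Fin p → Fin n → ℝ)
    {D D' : Set (Fin p → Fin n → ℝ)} (hD : MeasurableSet D) (hD' : MeasurableSet D') :
    Integrable (fun x => truncLR θ D x * truncLR θ' D' x) (law 0) := by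
  refine ((integrable_exp_pair (θ + θ')).mul_const
    (Real.exp (-(pair θ θ / 2) + -(pair θ' θ' / 2)))).mono'
    ((measurable_truncLR θ hD).mul (measurable_truncLR θ' hD')).aestronglyMeasurable
    (Eventually.of_forall fun x => ?_)
  rw [Real.norm_of_nonneg (mul_nonneg (truncLR_nonneg θ D x) (truncLR_nonneg θ' D' x)),
    ← Real.exp_add, pair_add_left]
  refine (mul_le_mul (truncLR_le θ D x) (truncLR_le θ' D' x) (truncLR_nonneg θ' D' x)
    (Real.exp_pos _).le).trans_eq ?_
  rw [← Real.exp_add]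
  congr 1; ring

lemma integral_truncLR {p n : ℕ} (θ : Fin p → Fin n → ℝ) {D : Set (Fin p → Fin n → ℝ)}
    (hD : MeasurableSet D) : ∫ x, truncLR θ D x ∂(law 0) = (law θ).real D := by
  rw [← integral_indicator_one hD, integral_law θ]
  refine integral_congr_ae (Eventually.of_forall fun x => ?_)
  by_cases hx : x ∈ D <;> simp [truncLR, hx]

/-- A second moment lower bound for the minimax error: the uniform mixture over a finite family of
alternatives, with likelihood ratios truncated to events `D α`. -/
lemma le_minimaxError_of_mixture {p n : ℕ} {ρ : ℝ} {s : ℕ} {A : Type*} [Fintype A] [Nonempty A]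
    (θ : A → Fin p → Fin n → ℝ) (hθ : ∀ α, θ α ∈ altSpace p n ρ s)
    (D : A → Set (Fin p → Fin n → ℝ)) (hD : ∀ α, MeasurableSet (D α)) {c₁ c₂ : ℝ}
    (h₁ : ∀ α, c₁ ≤ (law (θ α)).real (D α))
    (h₂ : ∑ α, ∑ α', ∫ x, truncLR (θ α) (D α) x * truncLR (θ α') (D α') x ∂(law 0)
      ≤ c₂ * (Fintype.card A : ℝ) ^ 2) :
    c₁ - c₂ / 4 ≤ minimaxError p n ρ s := by
  refine le_ciInf fun ψ => ?_
  obtain ⟨ψ, hψ⟩ := ψ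
  set N : ℝ := (Fintype.card A : ℝ) with hN
  have hN0 : 0 < N := by rw [hN]; exact_mod_cast Fintype.card_pos
  set g : A → (Fin p → Fin n → ℝ) → ℝ := fun α => truncLR (θ α) (D α) with hg
  have hgi : ∀ α, Integrable (g α) (law 0) := fun α => integrable_truncLR _ (hD α)
  have hggi : ∀ α α', Integrable (fun x => g α x * g α' x) (law 0) :=
    fun α α' => integrable_truncLR_mul _ _ (hD α) (hD α')
  have hz : (0 : Fin p → Fin n → ℝ) ∈ nullSpace p n := ⟨0, by simp⟩
  have hψg : ∀ α, Integrable (fun x => g α x * (1 - ψ x)) (law 0) := fun α =>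
    (hgi α).mul_bdd (c := 1) (compl_test hψ).1.aestronglyMeasurable
      (Eventually.of_forall fun x => by rcases (compl_test hψ).2 x with h | h <;> simp [h])
  have step1 : ∀ α, ∫ x, ψ x ∂(law 0) + ∫ x, g α x * (1 - ψ x) ∂(law 0)
      ≤ testingError p n ρ s ψ := by
    intro α
    refine le_trans (add_le_add le_rfl ?_) (le_testingError hψ hz (hθ α))
    rw [integral_law (θ α)]
    refine integral_mono_of_nonneg (Eventually.of_forall fun x => ?_) ?_
      (Eventually.of_forall fun x => ?_)
    · rcases (compl_test hψ).2 x with h | h <;> simp [h, hg, truncLR_nonneg]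
    · have := measurable_pair (θ α)
      refine Integrable.mul_bdd (c := 1) ?_ (compl_test hψ).1.aestronglyMeasurable
        (Eventually.of_forall fun x => by rcases (compl_test hψ).2 x with h | h <;> simp [h])
      simp only [sub_eq_add_neg, Real.exp_add]
      exact (integrable_exp_pair (θ α)).mul_const _
    · refine mul_le_mul_of_nonneg_right (truncLR_le _ _ x) ?_
      rcases (compl_test hψ).2 x with h | h <;> simp [h]
  have step2 : N * ∫ x, ψ x ∂(law 0) + ∑ α, ∫ x, g α x * (1 - ψ x) ∂(law 0)
      ≤ N * testingError p n ρ s ψ := by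
    have := Finset.sum_le_sum fun α (_ : α ∈ Finset.univ) => step1 α
    rw [Finset.sum_add_distrib] at this
    simpa [hN] using this
  have step3 : ∑ α, ∫ x, g α x ∂(law 0)
        - (∑ α, ∑ α', ∫ x, g α x * g α' x ∂(law 0)) / (4 * N)
      ≤ N * ∫ x, ψ x ∂(law 0) + ∑ α, ∫ x, g α x * (1 - ψ x) ∂(law 0) := by
    have hi1 : Integrable (fun x => ∑ α, g α x) (law 0) := integrable_finsetSum _ fun α _ => hgi α
    have hi2 : Integrable (fun x => ∑ α, ∑ α', g α x * g α' x) (law 0) :=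
      integrable_finsetSum _ fun α _ => integrable_finsetSum _ fun α' _ => hggi α α'
    have hi3 : Integrable (fun x => ∑ α, g α x * (1 - ψ x)) (law 0) :=
      integrable_finsetSum _ fun α _ => hψg α
    rw [← integral_finsetSum _ fun α _ => hgi α, ← integral_finsetSum _ fun α _ => hψg α]
    simp_rw [← integral_finsetSum _ fun α' _ => hggi _ α']
    rw [← integral_finsetSum _ fun α _ => integrable_finsetSum _ fun α' _ => hggi α α',
      ← integral_const_mul, ← integral_div, ← integral_sub hi1 (hi2.div_const _),
      ← integral_add ((integrable_test hψ _).const_mul _) hi3]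
    refine integral_mono (hi1.sub (hi2.div_const _))
      (((integrable_test hψ _).const_mul _).add hi3) fun x => ?_
    simp only [← Finset.sum_mul, ← Finset.mul_sum]
    set G := ∑ α, g α x
    have hG : 0 ≤ G * G / (4 * N) :=
      div_nonneg (mul_self_nonneg G) (by linarith)
    -- Both cases together say min(G, N) ≥ G - G²/(4N); for the value N this is (G - 2N)² ≥ 0.
    rcases hψ.2 x with h | h
    · rw [h]; linarith
    · rw [h, sub_le_iff_le_add]
      have : 0 ≤ (G - 2 * N) ^ 2 / (4 * N) := by positivity
      have e : (G - 2 * N) ^ 2 / (4 * N) = G * G / (4 * N) - G + N := by field_simp; ring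
      linarith
  have step4 : N * c₁ ≤ ∑ α, ∫ x, g α x ∂(law 0) := by
    have : ∑ _α : A, c₁ ≤ ∑ α, ∫ x, g α x ∂(law 0) :=
      Finset.sum_le_sum fun α _ => (h₁ α).trans_eq (integral_truncLR _ (hD α)).symm
    simpa [hN] using this
  have step5 : (∑ α, ∑ α', ∫ x, g α x * g α' x ∂(law 0)) / (4 * N) ≤ N * (c₂ / 4) := by
    rw [div_le_iff₀ (by positivity)]; linarith [h₂]
  refine le_of_mul_le_mul_left ?_ hN0
  rw [mul_sub]; linarith

/-! ### Linear statistics and cross moments of row-sparse signals -/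

lemma integral_exp_pair_law {p n : ℕ} (v θ : Fin p → Fin n → ℝ) :
    ∫ x, Real.exp (pair v x) ∂(law θ) = Real.exp (pair v θ + pair v v / 2) := by
  have hcomm : pair θ v = pair v θ := by
    unfold pair; exact Finset.sum_congr rfl fun j _ => Finset.sum_congr rfl fun i _ => mul_comm _ _
  have hright : ∀ x, pair x (θ + v) = pair x θ + pair x v := fun x => by
    simp [pair, mul_add, Finset.sum_add_distrib]
  have h : ∀ x, Real.exp (pair θ x - pair θ θ / 2) * Real.exp (pair v x)
      = Real.exp (-(pair θ θ / 2)) * Real.exp (pair (θ + v) x) := fun x => by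
    rw [← Real.exp_add, ← Real.exp_add, pair_add_left]; congr 1; ring
  rw [integral_law θ]
  simp_rw [h]
  rw [integral_const_mul, integral_exp_pair, ← Real.exp_add, pair_add_left, hright, hright, hcomm]
  congr 1; ring

lemma integrable_exp_pair_law {p n : ℕ} (v θ : Fin p → Fin n → ℝ) :
    Integrable (fun x => Real.exp (pair v x)) (law θ) := by
  by_contra h
  exact (Real.exp_pos _).ne' ((integral_exp_pair_law v θ).symm.trans (integral_undef h))

lemma pair_smul_left {p n : ℕ} (c : ℝ) (v x : Fin p → Fin n → ℝ) :
    pair (c • v) x = c * pair v x := by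
  simp [pair, Finset.mul_sum, mul_assoc]

lemma pair_smul_right {p n : ℕ} (c : ℝ) (v x : Fin p → Fin n → ℝ) :
    pair v (c • x) = c * pair v x := by
  simp [pair, Finset.mul_sum, mul_left_comm]

/-- Chernoff bound for a linear statistic. -/
lemma law_real_pair_ge_le {p n : ℕ} (v θ : Fin p → Fin n → ℝ) (hv : pair v v = 1) {c : ℝ}
    (hc : pair v θ ≤ c) :
    (law θ).real {x | c ≤ pair v x} ≤ Real.exp (-(c - pair v θ) ^ 2 / 2) := by
  have hi : Integrable (fun x => Real.exp ((c - pair v θ) * pair v x)) (law θ) := by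
    simpa only [pair_smul_left] using integrable_exp_pair_law ((c - pair v θ) • v) θ
  refine (measure_ge_le_exp_mul_mgf c (sub_nonneg.2 hc) hi).trans_eq ?_
  have := integral_exp_pair_law ((c - pair v θ) • v) θ
  simp only [pair_smul_left, pair_smul_right, hv] at this
  rw [mgf, this, ← Real.exp_add]
  congr 1; ring

/-- The matrix with rows `a j • u`. -/
def rowMat {p n : ℕ} (a : Fin p → ℝ) (u : Fin n → ℝ) : Fin p → Fin n → ℝ := fun j i => a j * u i

lemma pair_rowMat {p n : ℕ} (a b : Fin p → ℝ) (u w : Fin n → ℝ) :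
    pair (rowMat a u) (rowMat b w) = (∑ j, a j * b j) * ∑ i, u i * w i := by
  rw [Finset.sum_mul_sum]
  exact Finset.sum_congr rfl fun j _ => Finset.sum_congr rfl fun i _ => by
    simp only [rowMat]; ring

lemma pair_rowMat_left {p n : ℕ} (a : Fin p → ℝ) (u : Fin n → ℝ) (x : Fin p → Fin n → ℝ) :
    pair (rowMat a u) x = ∑ j, a j * ∑ i, u i * x j i := by
  simp only [pair, rowMat, Finset.mul_sum, mul_assoc]

/-- The function equal to `c` on `S` and to `0` elsewhere. -/
def onSet {ι : Type*} [DecidableEq ι] (S : Finset ι) (c : ℝ) : ι → ℝ :=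
  fun j => if j ∈ S then c else 0

lemma sum_onSet_mul {ι : Type*} [Fintype ι] [DecidableEq ι] (S : Finset ι) (c : ℝ) (f : ι → ℝ) :
    ∑ j, onSet S c j * f j = c * ∑ j ∈ S, f j := by
  simp [onSet, ite_mul, Finset.sum_ite_mem, Finset.mul_sum]

lemma sum_onSet_mul_onSet {ι : Type*} [Fintype ι] [DecidableEq ι] (S S' : Finset ι) (c c' : ℝ) :
    ∑ j, onSet S c j * onSet S' c' j = c * c' * (S ∩ S').card := by
  rw [sum_onSet_mul]
  simp [onSet, Finset.sum_ite_mem]; ring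

/-- The event that the statistics in direction `u` of the rows in `S` are at most `τ`. -/
def truncEvent {p n : ℕ} (S : Finset (Fin p)) (u : Fin n → ℝ) (τ : ℝ) :
    Set (Fin p → Fin n → ℝ) :=
  {x | ∀ j ∈ S, ∑ i, u i * x j i ≤ τ}

lemma measurableSet_truncEvent {p n : ℕ} (S : Finset (Fin p)) (u : Fin n → ℝ) (τ : ℝ) :
    MeasurableSet (truncEvent S u τ) := by
  have : truncEvent S u τ = ⋂ j ∈ S, {x : Fin p → Fin n → ℝ | ∑ i, u i * x j i ≤ τ} := by
    ext x; simp [truncEvent]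
  rw [this]
  refine Finset.measurableSet_biInter _ fun j _ => measurableSet_le ?_ measurable_const
  fun_prop

/-- Under the planted signal every statistic of `S` has mean `ρ`, so the truncation fails with
probability at most a union of Chernoff tails at distance `τ - ρ`. -/
lemma le_law_truncEvent {p n : ℕ} (S : Finset (Fin p)) (u : Fin n → ℝ) (hu : ∑ i, u i * u i = 1)
    {ρ τ : ℝ} (h : ρ ≤ τ) :
    1 - S.card * Real.exp (-(τ - ρ) ^ 2 / 2)
      ≤ (law (rowMat (onSet S ρ) u)).real (truncEvent S u τ) := by
  set P := law (rowMat (onSet S ρ) u)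
  have h1 : P.real (truncEvent S u τ)ᶜ ≤ S.card * Real.exp (-(τ - ρ) ^ 2 / 2) := by
    have hsub : (truncEvent S u τ)ᶜ ⊆ ⋃ j ∈ S, {x | τ ≤ pair (rowMat (onSet {j} 1) u) x} := by
      intro x hx
      simp only [truncEvent, Set.mem_compl_iff, Set.mem_ofPred_eq, not_forall, not_le] at hx
      obtain ⟨j, hj, hx⟩ := hx
      simp only [Set.mem_iUnion, Set.mem_ofPred_eq]
      refine ⟨j, hj, ?_⟩
      rw [pair_rowMat_left, sum_onSet_mul]
      simpa using hx.le
    refine (measureReal_mono hsub (measure_ne_top _ _)).trans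
      ((measureReal_biUnion_finset_le _ _).trans ?_)
    rw [← nsmul_eq_mul]
    refine Finset.sum_le_card_nsmul _ _ _ fun j hj => ?_
    have hv : pair (rowMat (onSet {j} 1) u) (rowMat (onSet {j} 1) u) = 1 := by
      rw [pair_rowMat, sum_onSet_mul_onSet, hu]; simp
    have hm : pair (rowMat (onSet {j} 1) u) (rowMat (onSet S ρ) u) = ρ := by
      rw [pair_rowMat, sum_onSet_mul_onSet, hu]; simp [hj]
    have := law_real_pair_ge_le _ (rowMat (onSet S ρ) u) hv (c := τ) (by rw [hm]; exact h)
    rwa [hm] at this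
  rw [measureReal_compl (measurableSet_truncEvent S u τ), probReal_univ] at h1
  linarith

/-- On `D` the indicator is dominated by the exponential of a nonnegative affine form, and the
indicator of `D'` is dropped. What remains is a Gaussian Laplace transform. -/
lemma integral_truncLR_mul_le_exp_pair {p n : ℕ} (θ θ' : Fin p → Fin n → ℝ)
    {D D' : Set (Fin p → Fin n → ℝ)} (hD : MeasurableSet D) (hD' : MeasurableSet D')
    (v : Fin p → Fin n → ℝ) (κ : ℝ)
    (h : ∀ x ∈ D, 0 ≤ κ + pair v x) :
    ∫ x, truncLR θ D x * truncLR θ' D' x ∂(law 0)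
      ≤ Real.exp (pair (θ + θ' + v) (θ + θ' + v) / 2 + κ - pair θ θ / 2 - pair θ' θ' / 2) := by
  have e : Real.exp (pair (θ + θ' + v) (θ + θ' + v) / 2 + κ - pair θ θ / 2 - pair θ' θ' / 2)
      = ∫ x, Real.exp (κ - pair θ θ / 2 - pair θ' θ' / 2) * Real.exp (pair (θ + θ' + v) x)
        ∂(law 0) := by
    rw [integral_const_mul, integral_exp_pair, ← Real.exp_add]; congr 1; ring
  rw [e]
  refine integral_mono (integrable_truncLR_mul θ θ' hD hD')
    ((integrable_exp_pair _).const_mul _) fun x => ?_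
  dsimp only
  rw [← Real.exp_add, pair_add_left, pair_add_left]
  by_cases hx : x ∈ D
  · refine (mul_le_mul (truncLR_le θ D x) (truncLR_le θ' D' x) (truncLR_nonneg θ' D' x)
      (Real.exp_pos _).le).trans ?_
    rw [← Real.exp_add]
    exact Real.exp_le_exp.2 (by linarith [h x hx])
  · simp only [truncLR, Set.indicator_of_notMem hx, zero_mul]
    positivity

/-- No tilt is needed here: the untruncated cross moment is the exponential of the inner product of
the two means, which is small for nearly orthogonal directions. -/
lemma integral_truncLR_mul_le_of_ne {p n : ℕ} (S S' : Finset (Fin p)) (u u' : Fin n → ℝ)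
    (ρ τ : ℝ) {ε : ℝ} (hε : ∑ i, u i * u' i ≤ ε) :
    ∫ x, truncLR (rowMat (onSet S ρ) u) (truncEvent S u τ) x
        * truncLR (rowMat (onSet S' ρ) u') (truncEvent S' u' τ) x ∂(law 0)
      ≤ Real.exp (ρ ^ 2 * ε) ^ (S ∩ S').card := by
  refine (integral_truncLR_mul_le_exp_pair _ _ (measurableSet_truncEvent S u τ)
    (measurableSet_truncEvent S' u' τ) 0 0 (by intro x _; simp [pair])).trans ?_
  have hr : ∀ x θ θ' : Fin p → Fin n → ℝ, pair x (θ + θ') = pair x θ + pair x θ' := by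
    intro x θ θ'; simp [pair, mul_add, Finset.sum_add_distrib]
  rw [← Real.exp_nat_mul]
  refine Real.exp_le_exp.2 ?_
  simp only [add_zero, pair_add_left, hr, pair_rowMat, sum_onSet_mul_onSet]
  have e : ∑ i, u' i * u i = ∑ i, u i * u' i := Finset.sum_congr rfl fun _ _ => mul_comm _ _
  rw [e, Finset.inter_comm S' S]
  have : ρ * ρ * (S ∩ S').card * ∑ i, u i * u' i ≤ ρ * ρ * (S ∩ S').card * ε :=
    mul_le_mul_of_nonneg_left hε (mul_nonneg (mul_self_nonneg ρ) (Nat.cast_nonneg _))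
  linarith

/-- The tilt by `-l` acts on the common rows only. Rows in just one of the sets cancel against the
normalisation, and each common row has combined mean `2ρ - l` and pays `lτ`. The case `l = 0` is the
untruncated moment exp(ρ²); `l` is optimised later. -/
lemma integral_truncLR_mul_le_of_eq {p n : ℕ} (S S' : Finset (Fin p)) (u : Fin n → ℝ)
    (hu : ∑ i, u i * u i = 1) (ρ τ : ℝ) {l : ℝ} (hl : 0 ≤ l) :
    ∫ x, truncLR (rowMat (onSet S ρ) u) (truncEvent S u τ) x
        * truncLR (rowMat (onSet S' ρ) u) (truncEvent S' u τ) x ∂(law 0)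
      ≤ Real.exp ((2 * ρ - l) ^ 2 / 2 + l * τ - ρ ^ 2) ^ (S ∩ S').card := by
  refine (integral_truncLR_mul_le_exp_pair _ _ (measurableSet_truncEvent S u τ)
    (measurableSet_truncEvent S' u τ) (rowMat (onSet (S ∩ S') (-l)) u)
    (l * τ * (S ∩ S').card) ?_).trans ?_
  · intro x hx
    rw [pair_rowMat_left, sum_onSet_mul]
    have : ∑ j ∈ S ∩ S', ∑ i, u i * x j i ≤ (S ∩ S').card • τ :=
      Finset.sum_le_card_nsmul _ _ _ fun j hj => hx j (Finset.mem_of_mem_inter_left hj)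
    rw [nsmul_eq_mul] at this
    nlinarith [mul_le_mul_of_nonneg_left this hl]
  have hr : ∀ x θ θ' : Fin p → Fin n → ℝ, pair x (θ + θ') = pair x θ + pair x θ' := by
    intro x θ θ'; simp [pair, mul_add, Finset.sum_add_distrib]
  rw [← Real.exp_nat_mul]
  refine Real.exp_le_exp.2 (le_of_eq ?_)
  simp only [pair_add_left, hr, pair_rowMat, sum_onSet_mul_onSet, hu]
  have e1 : S ∩ (S ∩ S') = S ∩ S' := by rw [← Finset.inter_assoc, Finset.inter_self]
  have e2 : S' ∩ (S ∩ S') = S ∩ S' := by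
    rw [Finset.inter_comm S S', ← Finset.inter_assoc, Finset.inter_self]
  rw [Finset.inter_comm S' S, Finset.inter_comm (S ∩ S') S, Finset.inter_comm (S ∩ S') S', e1, e2]
  simp only [Finset.inter_self]
  ring

/-! ### The prior: changepoint directions and random row sets -/

/-- The unit vector proportional to the indicator of the first `t` coordinates. -/
def segVec (n t : ℕ) : Fin n → ℝ := fun i => if (i : ℕ) < t then 1 / √(t : ℝ) else 0

lemma sum_segVec_mul {n t t' : ℕ} (htt' : t ≤ t') (ht' : t' ≤ n) :
    ∑ i, segVec n t i * segVec n t' i = √(t : ℝ) / √(t' : ℝ) := by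
  have h1 : ∀ i : Fin n, segVec n t i * segVec n t' i
      = if (i : ℕ) < t then 1 / √(t : ℝ) * (1 / √(t' : ℝ)) else 0 := by
    intro i
    by_cases h : (i : ℕ) < t
    · simp [segVec, h, h.trans_le htt']
    · simp [segVec, h]
  have hc : (Finset.univ.filter fun i : Fin n => (i : ℕ) < t).card = t := by
    rw [Fin.card_filter_val_lt]; omega
  rw [Finset.sum_congr rfl fun i _ => h1 i, ← Finset.sum_filter, Finset.sum_const, hc, nsmul_eq_mul]
  rcases Nat.eq_zero_or_pos t with h0 | h0
  · simp [h0]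
  · have : 0 < √(t : ℝ) := Real.sqrt_pos.2 (by exact_mod_cast h0)
    nth_rewrite 1 [← Real.mul_self_sqrt (Nat.cast_nonneg t)]
    field_simp

/-- The mean after the changepoint is 0, so the direction is not centred and the normalised jump is
only √((n - t)/n) times `ρ`. This factor is near 1 for changepoints far below n. -/
lemma rowMat_segVec_mem_altSpace {p n s t : ℕ} {ρ₀ ρ : ℝ} (S : Finset (Fin p)) (hS : S.card = s)
    (h1 : 1 ≤ t) (htn : t < n) (hρ : ρ₀ ≤ √(((n : ℝ) - t) / n) * ρ) :
    rowMat (onSet S ρ) (segVec n t) ∈ altSpace p n ρ₀ s := by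
  refine ⟨S, fun j => onSet S ρ j / √(t : ℝ), 0, t, hS.ge, h1, htn, fun j hj => ?_, fun j hj => ?_,
    fun j i => ?_⟩
  · have ht : (0 : ℝ) < t := by exact_mod_cast h1
    have hs : 0 < √(t : ℝ) := Real.sqrt_pos.2 ht
    rw [mul_div_assoc, Real.sqrt_mul ht.le]
    simp only [onSet, hj, if_true, Pi.zero_apply, sub_zero]
    refine hρ.trans_eq ?_
    field_simp
  · simp [onSet, hj]
  · by_cases h : (i : ℕ) < t <;> simp [rowMat, segVec, h, div_eq_mul_inv]

/-- The power is a product over blocks of factors `A` or 1. By distributivity the inner sum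
factorises, each block giving `m - 1` disagreements and one agreement. -/
lemma sum_sum_pow_card_agree (s m : ℕ) (A : ℝ) :
    ∑ f : Fin s → Fin m, ∑ f' : Fin s → Fin m,
        A ^ (Finset.univ.filter fun b => f b = f' b).card
      = (m : ℝ) ^ s * ((m : ℝ) - 1 + A) ^ s := by
  have h1 : ∀ f : Fin s → Fin m, ∑ f' : Fin s → Fin m,
        A ^ (Finset.univ.filter fun b => f b = f' b).card = ((m : ℝ) - 1 + A) ^ s := by
    intro f
    have h2 : ∀ f' : Fin s → Fin m, A ^ (Finset.univ.filter fun b => f b = f' b).card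
        = ∏ b, if f b = f' b then A else 1 := by
      intro f'
      rw [Finset.prod_ite, Finset.prod_const, Finset.prod_const_one, mul_one]
    have h3 := Finset.prod_univ_sum (fun _ : Fin s => (Finset.univ : Finset (Fin m)))
      (fun b j => if f b = j then A else 1)
    rw [Fintype.piFinset_univ] at h3
    rw [Finset.sum_congr rfl fun f' _ => h2 f', ← h3]
    have h4 : ∀ b, ∑ j : Fin m, (if f b = j then A else 1) = (m : ℝ) - 1 + A := by
      intro b
      have : ∀ j : Fin m, (if f b = j then A else 1) = 1 + if f b = j then A - 1 else 0 := by
        intro j; split_ifs <;> ring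
      rw [Finset.sum_congr rfl fun j _ => this j, Finset.sum_add_distrib, Finset.sum_ite_eq]
      simp; ring
    rw [Finset.prod_congr rfl fun b _ => h4 b, Finset.prod_const]
    simp
  rw [Finset.sum_congr rfl fun f _ => h1 f, Finset.sum_const, nsmul_eq_mul]
  simp

/-- The set of rows `e (b, f b)`. -/
def graphSet {p s m : ℕ} (e : Fin s × Fin m ↪ Fin p) (f : Fin s → Fin m) : Finset (Fin p) :=
  Finset.univ.image fun b => e (b, f b)

lemma card_graphSet {p s m : ℕ} (e : Fin s × Fin m ↪ Fin p) (f : Fin s → Fin m) :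
    (graphSet e f).card = s := by
  rw [graphSet, Finset.card_image_of_injective, Finset.card_univ, Fintype.card_fin]
  intro b b' h
  exact (Prod.ext_iff.1 (e.injective h)).1

/-- Blocks are disjoint because `e` is injective, so two sets meet only in blocks where the choices
agree. -/
lemma card_graphSet_inter {p s m : ℕ} (e : Fin s × Fin m ↪ Fin p) (f f' : Fin s → Fin m) :
    (graphSet e f ∩ graphSet e f').card = (Finset.univ.filter fun b => f b = f' b).card := by
  have : graphSet e f ∩ graphSet e f'
      = (Finset.univ.filter fun b => f b = f' b).image fun b => e (b, f b) := by
    ext j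
    simp only [graphSet, Finset.mem_inter, Finset.mem_image, Finset.mem_univ, true_and,
      Finset.mem_filter]
    constructor
    · rintro ⟨⟨b, hb⟩, b', hb'⟩
      have h := Prod.ext_iff.1 (e.injective (hb'.trans hb.symm))
      obtain ⟨h1, h2⟩ := h
      dsimp only at h1 h2
      subst h1
      exact ⟨b', h2.symm, hb⟩
    · rintro ⟨b, hb, rfl⟩
      exact ⟨⟨b, rfl⟩, b, by rw [hb]⟩
  rw [this, Finset.card_image_of_injective]
  intro b b' h
  exact (Prod.ext_iff.1 (e.injective h)).1

/-- Keeping `A - 1` instead of `A` makes the factor tend to 1 as `A` does; this serves the pairs of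
different changepoints. -/
lemma pow_mul_pow_le_exp {s m : ℕ} (hm : 0 < m) {A : ℝ} (hA : 0 ≤ A) :
    (m : ℝ) ^ s * ((m : ℝ) - 1 + A) ^ s
      ≤ Real.exp (s * (A - 1) / m) * ((m : ℝ) ^ s) ^ 2 := by
  have hm' : (1 : ℝ) ≤ m := by exact_mod_cast hm
  have h1 : (m : ℝ) - 1 + A ≤ m * Real.exp ((A - 1) / m) := by
    have := Real.add_one_le_exp ((A - 1) / m)
    calc (m : ℝ) - 1 + A = m * ((A - 1) / m + 1) := by field_simp; ring
      _ ≤ _ := mul_le_mul_of_nonneg_left this (by linarith)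
  have h2 : ((m : ℝ) - 1 + A) ^ s ≤ (m * Real.exp ((A - 1) / m)) ^ s :=
    pow_le_pow_left₀ (by linarith) h1 s
  have h3 : Real.exp (s * (A - 1) / m) = Real.exp ((A - 1) / m) ^ s := by
    rw [← Real.exp_nat_mul]; congr 1; ring
  rw [h3]
  calc (m : ℝ) ^ s * ((m : ℝ) - 1 + A) ^ s
      ≤ (m : ℝ) ^ s * (m * Real.exp ((A - 1) / m)) ^ s :=
        mul_le_mul_of_nonneg_left h2 (by positivity)
    _ = _ := by rw [mul_pow]; ring

/-- For pairs with the same changepoint `A / m` may be a positive power of p when s = 1. This form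
is then linear in `A / m` and can be absorbed by 1/K, unlike an exponential. -/
lemma pow_mul_pow_le_one_add_div_pow {s m : ℕ} (hm : 0 < m) {A : ℝ} (hA : 0 ≤ A) :
    (m : ℝ) ^ s * ((m : ℝ) - 1 + A) ^ s ≤ (1 + A / m) ^ s * ((m : ℝ) ^ s) ^ 2 := by
  have hm' : (1 : ℝ) ≤ m := by exact_mod_cast hm
  have h1 : (m : ℝ) - 1 + A ≤ m * (1 + A / m) := by
    rw [mul_add, mul_div_cancel₀ _ (by linarith)]; linarith
  have h2 : ((m : ℝ) - 1 + A) ^ s ≤ (m * (1 + A / m)) ^ s :=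
    pow_le_pow_left₀ (by linarith) h1 s
  calc (m : ℝ) ^ s * ((m : ℝ) - 1 + A) ^ s
      ≤ (m : ℝ) ^ s * (m * (1 + A / m)) ^ s := mul_le_mul_of_nonneg_left h2 (by positivity)
    _ = _ := by rw [mul_pow]; ring

/-- Lower bound for the minimax error by a prior that picks one row from each of `s` blocks of `m`
rows and one of `K` well separated changepoints. -/
lemma le_minimaxError {p n s m K : ℕ} {ρ₀ ρ τ l ε : ℝ} (hm : 0 < m) (hK : 0 < K)
    (hsm : s * m ≤ p) (hρτ : ρ ≤ τ) (hl : 0 ≤ l) (t : Fin K → ℕ)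
    (ht1 : ∀ k, 1 ≤ t k) (htn : ∀ k, t k < n) (hρ : ∀ k, ρ₀ ≤ √(((n : ℝ) - t k) / n) * ρ)
    (hε : ∀ k k', k < k' → t k ≤ t k' ∧ √(t k : ℝ) / √(t k' : ℝ) ≤ ε) :
    1 - s * Real.exp (-(τ - ρ) ^ 2 / 2)
      - ((1 + Real.exp ((2 * ρ - l) ^ 2 / 2 + l * τ - ρ ^ 2) / m) ^ s / K
        + Real.exp (s * (Real.exp (ρ ^ 2 * ε) - 1) / m)) / 4 ≤ minimaxError p n ρ₀ s := by
  obtain ⟨e⟩ : Nonempty (Fin s × Fin m ↪ Fin p) :=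
    Function.Embedding.nonempty_of_card_le (by simpa using hsm)
  have : Nonempty (Fin m) := ⟨⟨0, hm⟩⟩
  have : Nonempty (Fin K) := ⟨⟨0, hK⟩⟩
  have hunit : ∀ k, ∑ i, segVec n (t k) i * segVec n (t k) i = 1 := fun k => by
    rw [sum_segVec_mul le_rfl (htn k).le]
    exact div_self (Real.sqrt_pos.2 (by exact_mod_cast ht1 k)).ne'
  have hcross : ∀ k k', k ≠ k' → ∑ i, segVec n (t k) i * segVec n (t k') i ≤ ε := by
    intro k k' hk
    rcases lt_or_gt_of_ne hk with h | h
    · rw [sum_segVec_mul (hε k k' h).1 (htn k').le]; exact (hε k k' h).2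
    · rw [Finset.sum_congr rfl fun i _ => mul_comm _ _, sum_segVec_mul (hε k' k h).1 (htn k).le]
      exact (hε k' k h).2
  set A := Real.exp ((2 * ρ - l) ^ 2 / 2 + l * τ - ρ ^ 2) with hA
  set B := Real.exp (ρ ^ 2 * ε) with hB
  refine le_minimaxError_of_mixture (A := (Fin s → Fin m) × Fin K)
    (fun α => rowMat (onSet (graphSet e α.1) ρ) (segVec n (t α.2)))
    (fun α => rowMat_segVec_mem_altSpace _ (card_graphSet e α.1) (ht1 α.2) (htn α.2) (hρ α.2))
    (fun α => truncEvent (graphSet e α.1) (segVec n (t α.2)) τ)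
    (fun α => measurableSet_truncEvent _ _ _) (fun α => ?_) ?_
  · have := le_law_truncEvent (graphSet e α.1) (segVec n (t α.2)) (hunit α.2) hρτ
    rwa [card_graphSet] at this
  -- The second term is added on the diagonal as well, where it is superfluous, so that the sum over
  -- `k, k'` splits.
  have hbound : ∀ f f' k k', ∫ x,
      truncLR (rowMat (onSet (graphSet e f) ρ) (segVec n (t k)))
          (truncEvent (graphSet e f) (segVec n (t k)) τ) x
        * truncLR (rowMat (onSet (graphSet e f') ρ) (segVec n (t k')))
          (truncEvent (graphSet e f') (segVec n (t k')) τ) x ∂(law 0)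
      ≤ (if k = k' then A ^ (Finset.univ.filter fun b => f b = f' b).card else 0)
        + B ^ (Finset.univ.filter fun b => f b = f' b).card := by
    intro f f' k k'
    rw [← card_graphSet_inter e]
    split_ifs with h
    · subst h
      refine (integral_truncLR_mul_le_of_eq _ _ _ (hunit k) ρ τ hl).trans ?_
      exact le_add_of_nonneg_right (by positivity)
    · rw [zero_add]
      exact integral_truncLR_mul_le_of_ne _ _ _ _ ρ τ (hcross k k' h)
  have hsum : ∀ f f' : Fin s → Fin m, ∑ k : Fin K, ∑ k' : Fin K,
      ((if k = k' then A ^ (Finset.univ.filter fun b : Fin s => f b = f' b).card else 0)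
        + B ^ (Finset.univ.filter fun b : Fin s => f b = f' b).card)
      = K * A ^ (Finset.univ.filter fun b => f b = f' b).card
        + (K : ℝ) ^ 2 * B ^ (Finset.univ.filter fun b => f b = f' b).card := by
    intro f f'
    simp only [Finset.sum_add_distrib, Finset.sum_ite_eq, Finset.mem_univ, if_true,
      Finset.sum_const, Finset.card_univ, Fintype.card_fin, nsmul_eq_mul]
    ring
  have hA0 := pow_mul_pow_le_one_add_div_pow (s := s) hm (Real.exp_pos _ : 0 < A).le
  have hB0 := pow_mul_pow_le_exp (s := s) hm (Real.exp_pos _ : 0 < B).le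
  have hKpos : (0 : ℝ) < K := by exact_mod_cast hK
  simp only [Fintype.sum_prod_type, Fintype.card_prod, Fintype.card_fun, Fintype.card_fin,
    Nat.cast_mul, Nat.cast_pow]
  calc _ ≤ ∑ f : Fin s → Fin m, ∑ k : Fin K, ∑ f' : Fin s → Fin m, ∑ k' : Fin K,
        ((if k = k' then A ^ (Finset.univ.filter fun b : Fin s => f b = f' b).card else 0)
        + B ^ (Finset.univ.filter fun b : Fin s => f b = f' b).card) :=
        Finset.sum_le_sum fun f _ => Finset.sum_le_sum fun k _ => Finset.sum_le_sum fun f' _ =>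
          Finset.sum_le_sum fun k' _ => hbound f f' k k'
    _ = ∑ f : Fin s → Fin m, ∑ f' : Fin s → Fin m,
        (K * A ^ (Finset.univ.filter fun b => f b = f' b).card
        + (K : ℝ) ^ 2 * B ^ (Finset.univ.filter fun b => f b = f' b).card) := by
        refine Finset.sum_congr rfl fun f _ => ?_
        rw [Finset.sum_comm]
        exact Finset.sum_congr rfl fun f' _ => hsum f f'
    _ = K * ((m : ℝ) ^ s * ((m : ℝ) - 1 + A) ^ s)
        + (K : ℝ) ^ 2 * ((m : ℝ) ^ s * ((m : ℝ) - 1 + B) ^ s) := by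
        simp only [Finset.sum_add_distrib, ← Finset.mul_sum, sum_sum_pow_card_agree]
    _ ≤ K * ((1 + A / m) ^ s * ((m : ℝ) ^ s) ^ 2)
        + (K : ℝ) ^ 2 * (Real.exp (s * (B - 1) / m) * ((m : ℝ) ^ s) ^ 2) := by gcongr
    _ = _ := by field_simp

/-! ### Growth of n and s as powers of p -/

lemma exp_mul_log_natCast {p : ℕ} (hp : 0 < p) (c : ℝ) :
    Real.exp (c * Real.log (p : ℝ)) = (p : ℝ) ^ c := by
  rw [Real.rpow_def_of_pos (by exact_mod_cast hp), mul_comm]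

lemma tendsto_const_mul_rpow_zero (C : ℝ) {c : ℝ} (hc : c < 0) :
    Tendsto (fun p : ℕ => C * (p : ℝ) ^ c) atTop (𝓝 0) := by
  have h := (tendsto_rpow_neg_atTop (neg_pos.2 hc)).comp
    (tendsto_natCast_atTop_atTop (R := ℝ))
  simpa [Function.comp_def] using h.const_mul C

lemma tendsto_log_mul_rpow_zero {c : ℝ} (hc : c < 0) :
    Tendsto (fun p : ℕ => Real.log (p : ℝ) * (p : ℝ) ^ c) atTop (𝓝 0) := by
  have h := ((isLittleO_log_rpow_atTop (neg_pos.2 hc)).tendsto_div_nhds_zero).comp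
    (tendsto_natCast_atTop_atTop (R := ℝ))
  refine h.congr fun p => ?_
  rw [Function.comp, Real.rpow_neg (Nat.cast_nonneg p), div_inv_eq_mul]

lemma tendsto_rpow_natCast_atTop {c : ℝ} (hc : 0 < c) :
    Tendsto (fun p : ℕ => (p : ℝ) ^ c) atTop atTop :=
  (tendsto_rpow_atTop hc).comp tendsto_natCast_atTop_atTop

section Growth

variable {a : ℝ} {n : ℕ → ℕ}

lemma eventually_rpow_le_log (ha : 0 < a)
    (hn : Tendsto (fun p : ℕ => Real.log (Real.log (n p : ℝ)) / (a * Real.log (p : ℝ)))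
      atTop (𝓝 1)) {c : ℝ} (hc : c < a) : ∀ᶠ p : ℕ in atTop, (p : ℝ) ^ c ≤ Real.log (n p : ℝ) := by
  -- The maximum with `a / 2` keeps the exponent positive, which forces log log n > 0 and hence log
  -- n > 0 even though `Real.log 0 = 0`.
  have hc' : max c (a / 2) / a < 1 := (div_lt_one ha).2 (max_lt hc (half_lt_self ha))
  filter_upwards [hn.eventually_const_lt hc', eventually_ge_atTop 2] with p h hp
  have hp1 : (1 : ℝ) < p := by exact_mod_cast hp
  have hl : 0 < Real.log (p : ℝ) := Real.log_pos hp1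
  rw [lt_div_iff₀ (by positivity)] at h
  have e : max c (a / 2) / a * (a * Real.log (p : ℝ)) = max c (a / 2) * Real.log p := by
    field_simp
  rw [e] at h
  have h0 : 0 < Real.log (Real.log (n p : ℝ)) :=
    lt_of_le_of_lt (mul_nonneg ((half_pos ha).le.trans (le_max_right _ _)) hl.le) h
  have h1 : 0 < Real.log (n p : ℝ) := by
    refine lt_of_le_of_ne (Real.log_natCast_nonneg _) fun h2 => ?_
    rw [← h2] at h0; simp at h0
  rw [← Real.exp_log h1, ← exp_mul_log_natCast (by omega)]
  exact Real.exp_le_exp.2 ((mul_le_mul_of_nonneg_right (le_max_left _ _) hl.le).trans h.le)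

lemma eventually_log_le_rpow (ha : 0 < a)
    (hn : Tendsto (fun p : ℕ => Real.log (Real.log (n p : ℝ)) / (a * Real.log (p : ℝ)))
      atTop (𝓝 1)) {c : ℝ} (hc : a < c) : ∀ᶠ p : ℕ in atTop, Real.log (n p : ℝ) ≤ (p : ℝ) ^ c := by
  have hc' : 1 < c / a := (one_lt_div ha).2 hc
  filter_upwards [hn.eventually_lt_const hc', eventually_ge_atTop 2] with p h hp
  have hp1 : (1 : ℝ) < p := by exact_mod_cast hp
  have hl : 0 < Real.log (p : ℝ) := Real.log_pos hp1
  rw [div_lt_iff₀ (by positivity)] at h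
  have e : c / a * (a * Real.log (p : ℝ)) = c * Real.log p := by field_simp
  rw [e] at h
  rcases (Real.log_natCast_nonneg (n p)).eq_or_lt with h1 | h1
  · rw [← h1]; positivity
  · rw [← Real.exp_log h1, ← exp_mul_log_natCast (by omega)]
    exact Real.exp_le_exp.2 h.le

end Growth

section Sparsity

variable {β : ℝ} {s : ℕ → ℕ}

lemma eventually_sparsity_le
    (hs : Tendsto (fun p : ℕ => (s p : ℝ) / (p : ℝ) ^ (1 - β)) atTop (𝓝 1)) :
    ∀ᶠ p : ℕ in atTop, (s p : ℝ) ≤ 2 * (p : ℝ) ^ (1 - β) := by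
  filter_upwards [hs.eventually_lt_const one_lt_two, eventually_gt_atTop 0] with p h hp
  have : (0 : ℝ) < p := by exact_mod_cast hp
  exact ((div_lt_iff₀ (by positivity)).1 h).le

lemma eventually_le_sparsity
    (hs : Tendsto (fun p : ℕ => (s p : ℝ) / (p : ℝ) ^ (1 - β)) atTop (𝓝 1)) :
    ∀ᶠ p : ℕ in atTop, 1 / 2 * (p : ℝ) ^ (1 - β) ≤ s p := by
  filter_upwards [hs.eventually_const_lt one_half_lt_one, eventually_gt_atTop 0] with p h hp
  have : (0 : ℝ) < p := by exact_mod_cast hp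
  exact ((lt_div_iff₀ (by positivity)).1 h).le

lemma eventually_sparsity_eq_one
    (hs : Tendsto (fun p : ℕ => (s p : ℝ) / (p : ℝ) ^ (1 - (1 : ℝ))) atTop (𝓝 1)) :
    ∀ᶠ p : ℕ in atTop, s p = 1 := by
  filter_upwards [hs.eventually_lt_const (by norm_num : (1 : ℝ) < 2),
    hs.eventually_const_lt (by norm_num : (0 : ℝ) < 1)] with p h h'
  simp only [sub_self, Real.rpow_zero, div_one] at h h'
  have h1 : s p < 2 := by exact_mod_cast h
  have h2 : 0 < s p := by exact_mod_cast h'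
  omega

/-- The block size `p / s` is at least `p / (2 s)`. -/
lemma eventually_block_size (hβ : 1 / 2 < β)
    (hs : Tendsto (fun p : ℕ => (s p : ℝ) / (p : ℝ) ^ (1 - β)) atTop (𝓝 1)) :
    ∀ᶠ p : ℕ in atTop, 0 < s p ∧ 0 < p / s p ∧
      (s p : ℝ) / ((p / s p : ℕ) : ℝ) ≤ 8 * (p : ℝ) ^ (1 - 2 * β) := by
  have h0 := (tendsto_const_mul_rpow_zero 4 (by linarith : -β < 0)).eventually_le_const one_pos
  filter_upwards [eventually_sparsity_le hs, eventually_le_sparsity hs, h0,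
    eventually_gt_atTop 0] with p h1 h2 h3 hp
  have hp0 : (0 : ℝ) < p := by exact_mod_cast hp
  have hs0 : (0 : ℝ) < s p := lt_of_lt_of_le (by positivity) h2
  have hsn : 0 < s p := by exact_mod_cast hs0
  have h4 : 2 * (s p : ℝ) ≤ p := by
    have e : (p : ℝ) ^ (1 - β) = p * (p : ℝ) ^ (-β) := by
      rw [sub_eq_add_neg, Real.rpow_add hp0, Real.rpow_one]
    rw [e] at h1
    nlinarith [mul_le_mul_of_nonneg_left h3 hp0.le]
  have h5 : 2 * s p ≤ p := by exact_mod_cast h4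
  have h6 : 0 < p / s p := Nat.div_pos (by omega) hsn
  refine ⟨hsn, h6, ?_⟩
  have h7 : (p : ℝ) ≤ 2 * ((p / s p : ℕ) : ℝ) * s p := by
    -- The quotient q is at least 1, so q + 1 ≤ 2q absorbs the floor at the cost of a factor 2.
    have h8 : p < s p * (p / s p + 1) := Nat.lt_mul_div_succ p hsn
    have h9 : p ≤ 2 * (p / s p) * s p := by nlinarith [h8, h6, hsn]
    exact_mod_cast h9
  have h10 : (0 : ℝ) < ((p / s p : ℕ) : ℝ) := by exact_mod_cast h6
  have h11 : (s p : ℝ) * s p ≤ 4 * ((p : ℝ) ^ (1 - 2 * β) * p) := by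
    have e : (p : ℝ) ^ (1 - 2 * β) * p = (p : ℝ) ^ (1 - β) * (p : ℝ) ^ (1 - β) := by
      rw [← Real.rpow_add hp0, ← Real.rpow_add_one hp0.ne']; congr 1; ring
    rw [e]
    nlinarith [mul_le_mul h1 h1 hs0.le (by positivity)]
  rw [div_le_iff₀ h10]
  have h12 : 0 < (p : ℝ) ^ (1 - 2 * β) := by positivity
  refine le_of_mul_le_mul_right ?_ hs0
  nlinarith [mul_le_mul_of_nonneg_left h7 h12.le]

end Sparsity

/-! ### The lower bound in the asymptotic regime -/

lemma sqrt_two_mul_log_sq {p : ℕ} : √(2 * Real.log (p : ℝ)) ^ 2 = 2 * Real.log (p : ℝ) :=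
  Real.sq_sqrt (mul_nonneg zero_le_two (Real.log_natCast_nonneg p))

/-- The changepoints `p ^ k`, `k < p ^ κ`, are eventually small compared to `n`. -/
lemma eventually_pow_le {a κ : ℝ} {n : ℕ → ℕ} (ha : 0 < a) (hκ : κ < a)
    (hn : Tendsto (fun p : ℕ => Real.log (Real.log (n p : ℝ)) / (a * Real.log (p : ℝ)))
      atTop (𝓝 1)) : ∀ᶠ p : ℕ in atTop, p ^ ⌊(p : ℝ) ^ κ⌋₊ ≤ n p := by
  -- The gap between `κ` and `c` absorbs the factor log p in log(p^(p^κ)).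
  obtain ⟨c, hc1, hc2⟩ := exists_between (max_lt hκ ha)
  have hκc := (le_max_left κ 0).trans_lt hc1
  have hc0 := (le_max_right κ 0).trans_lt hc1
  filter_upwards [eventually_rpow_le_log ha hn hc2, eventually_gt_atTop 0,
    (tendsto_log_mul_rpow_zero (by linarith : κ - c < 0)).eventually_le_const one_pos]
    with p h1 hp h2
  have hp0 : (0 : ℝ) < p := by exact_mod_cast hp
  have hl : 0 < Real.log (n p : ℝ) := lt_of_lt_of_le (by positivity) h1
  have hn0 : 0 < n p := by
    rcases Nat.eq_zero_or_pos (n p) with h | h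
    · simp [h] at hl
    · exact h
  have hn0' : (0 : ℝ) < n p := by exact_mod_cast hn0
  have h3 : (⌊(p : ℝ) ^ κ⌋₊ : ℝ) * Real.log p ≤ Real.log (n p) := by
    refine le_trans ?_ h1
    have h4 : (⌊(p : ℝ) ^ κ⌋₊ : ℝ) ≤ (p : ℝ) ^ κ := Nat.floor_le (by positivity)
    have e : (p : ℝ) ^ κ = (p : ℝ) ^ (κ - c) * (p : ℝ) ^ c := by
      rw [← Real.rpow_add hp0]; congr 1; ring
    calc (⌊(p : ℝ) ^ κ⌋₊ : ℝ) * Real.log p ≤ (p : ℝ) ^ κ * Real.log p :=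
          mul_le_mul_of_nonneg_right h4 (Real.log_natCast_nonneg p)
      _ = Real.log p * (p : ℝ) ^ (κ - c) * (p : ℝ) ^ c := by rw [e]; ring
      _ ≤ 1 * (p : ℝ) ^ c := mul_le_mul_of_nonneg_right h2 (by positivity)
      _ = _ := one_mul _
  have h5 : ((p ^ ⌊(p : ℝ) ^ κ⌋₊ : ℕ) : ℝ) ≤ n p := by
    rw [← Real.log_le_log_iff (by positivity) hn0', Nat.cast_pow, Real.log_pow]
    exact h3
  exact_mod_cast h5

/-- Here `x`, `y`, `z` are signal, truncation level and tilt in units of √(2 log p). The slack √r <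
x pays for the uncentred direction, and `hβxy` makes the truncation loss s p^(-(y-x)²) vanish.
`hmain` is the moment of equal changepoints. The constants combine to 1 - 1/8 - (5/4 + 5/4)/4 = 1/4.
-/
lemma eventually_le_minimaxError {a β r κ x y z : ℝ} {n s : ℕ → ℕ} (ha : 0 < a)
    (hβ : 1 / 2 < β) (hr : 0 ≤ r) (hκ0 : 0 ≤ κ) (hκ : κ < a) (hx : √r < x) (hxy : x < y)
    (hz : 0 ≤ z) (hβxy : 1 - β < (y - x) ^ 2)
    (hn : Tendsto (fun p : ℕ => Real.log (Real.log (n p : ℝ)) / (a * Real.log (p : ℝ)))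
      atTop (𝓝 1))
    (hs : Tendsto (fun p : ℕ => (s p : ℝ) / (p : ℝ) ^ (1 - β)) atTop (𝓝 1))
    (hmain : ∀ᶠ p : ℕ in atTop,
      (1 + (p : ℝ) ^ ((2 * x - z) ^ 2 + 2 * z * y - 2 * x ^ 2) / ((p / s p : ℕ) : ℝ)) ^ s p
        / (⌊(p : ℝ) ^ κ⌋₊ : ℝ) ≤ 5 / 4) :
    ∀ᶠ p : ℕ in atTop,
      1 / 4 ≤ minimaxError p (n p) (√(2 * r * Real.log (p : ℝ))) (s p) := by
  have hx0 : 0 < x := (Real.sqrt_nonneg r).trans_lt hx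
  have hrx : r / x ^ 2 < 1 := by
    rw [div_lt_one (by positivity)]; exact (Real.sqrt_lt' hx0).1 hx
  have hA := (tendsto_const_mul_rpow_zero 2
    (by linarith : 1 - β - (y - x) ^ 2 < 0)).eventually_le_const (by norm_num : (0 : ℝ) < 1 / 8)
  have hB := ((tendsto_log_mul_rpow_zero (by norm_num : (-(1 / 2) : ℝ) < 0)).const_mul
    (2 * x ^ 2)).eventually_le_const (by
      rw [mul_zero]; exact Real.log_pos (by norm_num) : 2 * x ^ 2 * 0 < Real.log (1 + 1 / 5))
  have hC := (tendsto_const_mul_rpow_zero 1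
    (by norm_num : (-1 : ℝ) < 0)).eventually_le_const (sub_pos.2 hrx)
  have hD := (tendsto_const_mul_rpow_zero 8
    (by linarith : 1 - 2 * β < 0)).eventually_le_const one_pos
  filter_upwards [hmain, eventually_pow_le ha hκ hn, eventually_block_size hβ hs,
    eventually_sparsity_le hs, hA, hB, hC, hD, eventually_ge_atTop 2]
    with p hmain hpow ⟨hs0, hm0, hsm⟩ hsle hA hB hC hD hp
  have hp0 : (0 : ℝ) < p := by exact_mod_cast (by omega : 0 < p)
  have hp1 : (1 : ℝ) ≤ p := by exact_mod_cast (by omega : 1 ≤ p)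
  set L := √(2 * Real.log (p : ℝ)) with hL
  have hL0 : 0 ≤ L := Real.sqrt_nonneg _
  have hL2 : L ^ 2 = 2 * Real.log (p : ℝ) := sqrt_two_mul_log_sq
  have hK : 0 < ⌊(p : ℝ) ^ κ⌋₊ := Nat.floor_pos.2 (Real.one_le_rpow hp1 hκ0)
  have hkn : ∀ k : Fin ⌊(p : ℝ) ^ κ⌋₊, p ^ (k : ℕ) * p ≤ n p := fun k => by
    rw [← pow_succ]
    exact (Nat.pow_le_pow_right (by omega) k.2).trans hpow
  have hkpos : ∀ k : Fin ⌊(p : ℝ) ^ κ⌋₊, 1 ≤ p ^ (k : ℕ) := fun k =>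
    Nat.one_le_pow _ _ (by omega)
  have hklt : ∀ k : Fin ⌊(p : ℝ) ^ κ⌋₊, p ^ (k : ℕ) < n p := fun k => by
    nlinarith [hkn k, hkpos k]
  -- Changepoints p^k have successive ratio p, so their directions overlap by at most p^(-1/2),
  -- which beats the factor log p in the squared signal.
  have key := le_minimaxError (p := p) (n := n p) (s := s p) (m := p / s p)
    (K := ⌊(p : ℝ) ^ κ⌋₊) (ρ₀ := √(2 * r * Real.log (p : ℝ))) (ρ := x * L) (τ := y * L)
    (l := z * L) (ε := (p : ℝ) ^ (-(1 / 2) : ℝ)) hm0 hK (Nat.mul_div_le p (s p))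
    (mul_le_mul_of_nonneg_right hxy.le hL0) (mul_nonneg hz hL0) (fun k => p ^ (k : ℕ)) hkpos hklt
    (fun k => ?_) (fun k k' hkk' => ?_)
  · refine le_trans ?_ key
    have e1 : Real.exp (-(y * L - x * L) ^ 2 / 2) = (p : ℝ) ^ (-(y - x) ^ 2) := by
      rw [← exp_mul_log_natCast (by omega)]
      congr 1
      rw [← sub_mul, mul_pow, hL2]; ring
    have e2 : Real.exp ((2 * (x * L) - z * L) ^ 2 / 2 + z * L * (y * L) - (x * L) ^ 2)
        = (p : ℝ) ^ ((2 * x - z) ^ 2 + 2 * z * y - 2 * x ^ 2) := by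
      rw [← exp_mul_log_natCast (by omega)]
      congr 1
      have : (2 * (x * L) - z * L) ^ 2 / 2 + z * L * (y * L) - (x * L) ^ 2
        = ((2 * x - z) ^ 2 / 2 + z * y - x ^ 2) * L ^ 2 := by ring
      rw [this, hL2]; ring
    have b1 : (s p : ℝ) * Real.exp (-(y * L - x * L) ^ 2 / 2) ≤ 1 / 8 := by
      rw [e1]
      refine le_trans ?_ hA
      rw [sub_eq_add_neg (1 - β), Real.rpow_add hp0, ← mul_assoc]
      exact mul_le_mul_of_nonneg_right hsle (by positivity)
    have b3 : Real.exp (s p * (Real.exp ((x * L) ^ 2 * (p : ℝ) ^ (-(1 / 2) : ℝ)) - 1)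
        / ((p / s p : ℕ) : ℝ)) ≤ 5 / 4 := by
      have h1 : Real.exp ((x * L) ^ 2 * (p : ℝ) ^ (-(1 / 2) : ℝ)) ≤ 1 + 1 / 5 := by
        rw [← Real.exp_log (by norm_num : (0 : ℝ) < 1 + 1 / 5)]
        refine Real.exp_le_exp.2 (le_trans (le_of_eq ?_) hB)
        rw [mul_pow, hL2]; ring
      have h2 : 0 ≤ (s p : ℝ) / ((p / s p : ℕ) : ℝ) := by positivity
      have h3 : (s p : ℝ) * (Real.exp ((x * L) ^ 2 * (p : ℝ) ^ (-(1 / 2) : ℝ)) - 1)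
          / ((p / s p : ℕ) : ℝ) ≤ 1 / 5 := by
        rw [mul_div_right_comm]
        have h4 : 0 ≤ Real.exp ((x * L) ^ 2 * (p : ℝ) ^ (-(1 / 2) : ℝ)) - 1 :=
          sub_nonneg.2 (Real.one_le_exp (by positivity))
        nlinarith [hsm.trans hD]
      have h5 : Real.exp (1 / 5) ≤ 5 / 4 := by
        have := Real.exp_bound_div_one_sub_of_interval (by norm_num : (0 : ℝ) ≤ 1 / 5) (by norm_num)
        norm_num at this ⊢
        exact this
      exact (Real.exp_le_exp.2 h3).trans h5
    rw [e2]
    linarith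
  · rw [mul_comm 2 r, mul_assoc, Real.sqrt_mul hr, ← hL, ← mul_assoc]
    refine mul_le_mul_of_nonneg_right ?_ hL0
    have hn0 : (0 : ℝ) < n p := by exact_mod_cast (Nat.zero_le _).trans_lt (hklt k)
    have h1 : r / x ^ 2 ≤ ((n p : ℝ) - ((p ^ (k : ℕ) : ℕ) : ℝ)) / n p := by
      have h2 : ((p ^ (k : ℕ) : ℕ) : ℝ) / n p ≤ 1 * (p : ℝ) ^ (-1 : ℝ) := by
        rw [Real.rpow_neg_one, one_mul, div_le_iff₀ hn0, inv_mul_eq_div, le_div_iff₀ hp0]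
        exact_mod_cast hkn k
      rw [sub_div, div_self hn0.ne']
      linarith
    have h3 : √r = √(r / x ^ 2) * x := by
      rw [Real.sqrt_div hr, Real.sqrt_sq hx0.le, div_mul_cancel₀ _ hx0.ne']
    rw [h3]
    exact mul_le_mul_of_nonneg_right (Real.sqrt_le_sqrt h1) hx0.le
  · refine ⟨Nat.pow_le_pow_right (by omega) (le_of_lt hkk'), ?_⟩
    have h1 : (0 : ℝ) < ((p ^ (k' : ℕ) : ℕ) : ℝ) := by exact_mod_cast hkpos k'
    rw [Real.rpow_neg hp0.le, ← Real.sqrt_eq_rpow, div_le_iff₀ (Real.sqrt_pos.2 h1), inv_mul_eq_div,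
      le_div_iff₀ (Real.sqrt_pos.2 hp0), ← Real.sqrt_mul (Nat.cast_nonneg _)]
    refine Real.sqrt_le_sqrt ?_
    have : p ^ (k : ℕ) * p ≤ p ^ (k' : ℕ) := by
      rw [← pow_succ]; exact Nat.pow_le_pow_right (by omega) hkk'
    exact_mod_cast this

/-- With one planted row the second moment is about A/(pK), so the K ≈ p^κ changepoints act like
additional rows. The tilt `z = x` is the limit of the optimal `2x - y` as y approaches x. -/
lemma eventually_le_minimaxError_of_one {a r : ℝ} {n s : ℕ → ℕ} (ha : 0 < a)
    (hr : 0 ≤ r) (hra : r < 1 + a)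
    (hn : Tendsto (fun p : ℕ => Real.log (Real.log (n p : ℝ)) / (a * Real.log (p : ℝ)))
      atTop (𝓝 1))
    (hs : Tendsto (fun p : ℕ => (s p : ℝ) / (p : ℝ) ^ (1 - (1 : ℝ))) atTop (𝓝 1)) :
    ∀ᶠ p : ℕ in atTop,
      1 / 4 ≤ minimaxError p (n p) (√(2 * r * Real.log (p : ℝ))) (s p) := by
  -- `κ > r - 1` leaves room for the signal; `κ > 0` makes 1/K vanish.
  obtain ⟨κ, hκ1, hκa⟩ := exists_between (max_lt (sub_left_lt_of_lt_add hra) ha : max (r - 1) 0 < a)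
  have hκr := (le_max_left (r - 1) 0).trans_lt hκ1
  have hκ0 := (le_max_right (r - 1) 0).trans_lt hκ1
  obtain ⟨y, hy1, hy2⟩ := exists_between (Real.sqrt_lt_sqrt hr (by linarith : r < 1 + κ))
  obtain ⟨x, hx1, hx2⟩ := exists_between hy1
  have hx0 : 0 ≤ x := (Real.sqrt_nonneg r).trans hx1.le
  have hyκ : y ^ 2 < 1 + κ := by
    have := Real.lt_sqrt (hx0.trans hx2.le) |>.1 hy2
    exact this
  refine eventually_le_minimaxError (z := x) ha (by norm_num) hr hκ0.le hκa hx1 hx2 hx0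
    (by rw [sub_self]; exact pow_pos (sub_pos.2 hx2) 2) hn hs ?_
  set E := (2 * x - x) ^ 2 + 2 * x * y - 2 * x ^ 2 with hE
  -- The exponent E equals y² - (y - x)².
  have hE' : E - 1 - κ < 0 := by rw [hE]; nlinarith [sq_nonneg (x - y)]
  filter_upwards [eventually_sparsity_eq_one hs, eventually_ge_atTop 1,
    (tendsto_const_mul_rpow_zero 2 hE').eventually_le_const (by norm_num : (0 : ℝ) < 1 / 4),
    (tendsto_const_mul_rpow_zero 2 (by linarith : -κ < 0)).eventually_le_const one_pos]
    with p hs1 hp h1 h2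
  have hp0 : (0 : ℝ) < p := by exact_mod_cast hp
  have hp1 : (1 : ℝ) ≤ p := by exact_mod_cast hp
  have hK : (p : ℝ) ^ κ / 2 ≤ (⌊(p : ℝ) ^ κ⌋₊ : ℝ) := by
    have h3 := Nat.lt_floor_add_one ((p : ℝ) ^ κ)
    have h4 : (1 : ℝ) ≤ ⌊(p : ℝ) ^ κ⌋₊ := by
      exact_mod_cast Nat.floor_pos.2 (Real.one_le_rpow hp1 hκ0.le)
    linarith
  have hK1 : (1 : ℝ) ≤ ⌊(p : ℝ) ^ κ⌋₊ := by
    exact_mod_cast Nat.floor_pos.2 (Real.one_le_rpow hp1 hκ0.le)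
  have hpκ : 0 < (p : ℝ) ^ κ := by positivity
  rw [hs1, Nat.div_one, pow_one, div_le_iff₀ (by linarith)]
  have e : (p : ℝ) ^ (E - 1 - κ) * (p : ℝ) ^ κ = (p : ℝ) ^ E / p := by
    rw [← Real.rpow_add hp0, div_eq_mul_inv, ← Real.rpow_neg_one, ← Real.rpow_add hp0]
    congr 1; ring
  rw [← e]
  nlinarith [mul_le_mul_of_nonneg_right h1 hpκ.le]

/-- With `κ = 0` the only changepoint is p^0 = 1, so the problem is sparse detection at a known
location. The truncation level `y = 1` is the height of the maximum of p noise variables. -/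
lemma eventually_le_minimaxError_of_lt_one {a β r x z : ℝ} {n s : ℕ → ℕ} (ha : 0 < a)
    (hβ : 1 / 2 < β) (hr : 0 ≤ r) (hx : √r < x) (hx1 : x < 1) (hz : 0 ≤ z)
    (hβx : 1 - β < (1 - x) ^ 2)
    (hE : 1 - 2 * β + ((2 * x - z) ^ 2 + 2 * z - 2 * x ^ 2) < 0)
    (hn : Tendsto (fun p : ℕ => Real.log (Real.log (n p : ℝ)) / (a * Real.log (p : ℝ)))
      atTop (𝓝 1))
    (hs : Tendsto (fun p : ℕ => (s p : ℝ) / (p : ℝ) ^ (1 - β)) atTop (𝓝 1)) :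
    ∀ᶠ p : ℕ in atTop,
      1 / 4 ≤ minimaxError p (n p) (√(2 * r * Real.log (p : ℝ))) (s p) := by
  refine eventually_le_minimaxError (y := 1) (κ := 0) ha hβ hr le_rfl ha hx hx1 hz hβx hn hs ?_
  filter_upwards [eventually_block_size hβ hs, eventually_gt_atTop 0,
    (tendsto_const_mul_rpow_zero 8 hE).eventually_le_const (by norm_num : (0 : ℝ) < 1 / 5)]
    with p ⟨hs0, hm0, hsm⟩ hp h1
  have hp0 : (0 : ℝ) < p := by exact_mod_cast hp
  rw [Real.rpow_zero, Nat.floor_one, Nat.cast_one, div_one, mul_one]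
  set E := (2 * x - z) ^ 2 + 2 * z - 2 * x ^ 2
  have h2 : (1 + (p : ℝ) ^ E / ((p / s p : ℕ) : ℝ)) ^ s p
      ≤ Real.exp (s p * ((p : ℝ) ^ E / ((p / s p : ℕ) : ℝ))) := by
    rw [Real.exp_nat_mul]
    refine pow_le_pow_left₀ (by positivity) ?_ _
    rw [add_comm]; exact Real.add_one_le_exp _
  have h3 : s p * ((p : ℝ) ^ E / ((p / s p : ℕ) : ℝ)) ≤ 1 / 5 := by
    refine le_trans ?_ h1
    rw [Real.rpow_add hp0, ← mul_assoc, mul_div_left_comm, mul_comm]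
    exact mul_le_mul_of_nonneg_right hsm (by positivity)
  have h5 : Real.exp (1 / 5) ≤ 5 / 4 := by
    have := Real.exp_bound_div_one_sub_of_interval (by norm_num : (0 : ℝ) ≤ 1 / 5) (by norm_num)
    norm_num at this ⊢
    exact this
  exact h2.trans ((Real.exp_le_exp.2 h3).trans h5)

/-- Below the detection boundary the minimax error stays bounded away from zero. -/
lemma eventually_le_minimaxError_of_lt_boundary {a β r : ℝ} {n s : ℕ → ℕ} (ha : 0 < a)
    (hβ : 1 / 2 < β) (hβ1 : β ≤ 1) (hr : 0 ≤ r) (hrb : r < boundary a β)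
    (hn : Tendsto (fun p : ℕ => Real.log (Real.log (n p : ℝ)) / (a * Real.log (p : ℝ)))
      atTop (𝓝 1))
    (hs : Tendsto (fun p : ℕ => (s p : ℝ) / (p : ℝ) ^ (1 - β)) atTop (𝓝 1)) :
    ∀ᶠ p : ℕ in atTop,
      1 / 4 ≤ minimaxError p (n p) (√(2 * r * Real.log (p : ℝ))) (s p) := by
  unfold boundary at hrb
  split_ifs at hrb with h1 h2
  · obtain ⟨x, hx1, hx2⟩ := exists_between (Real.sqrt_lt_sqrt hr hrb)
    have hx0 : 0 ≤ x := (Real.sqrt_nonneg r).trans hx1.le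
    have hxb : x ^ 2 < β - 1 / 2 := (Real.lt_sqrt hx0).1 hx2
    refine eventually_le_minimaxError_of_lt_one (x := x) (z := 0) ha hβ hr hx1 ?_ le_rfl ?_ ?_ hn hs
    · nlinarith
    -- Indeed (1 - x)² - (1 - β) = 2(x - 1/2)² + (β - 1/2 - x²).
    · nlinarith [sq_nonneg (x - 1 / 2)]
    · nlinarith
  · have hq : √(1 - β) < 1 / 2 := by
      rw [Real.sqrt_lt' (by norm_num)]; linarith
    have hrb' : √r < 1 - √(1 - β) := (Real.sqrt_lt' (by linarith)).2 hrb
    -- Requiring x > 1/2 keeps the tilt `2x - 1` nonnegative. This tilt minimises the exponent,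
    -- which becomes 1 - 2(1 - x)², so the moment condition reduces to (1 - x)² > 1 - β.
    obtain ⟨x, hx1, hx2⟩ := exists_between (max_lt hrb' (by linarith : 1 / 2 < 1 - √(1 - β)))
    have hxr := (le_max_left _ _).trans_lt hx1
    have hxh := (le_max_right _ _).trans_lt hx1
    have hx3 : x < 1 := by linarith [Real.sqrt_nonneg (1 - β)]
    have hx4 : 1 - β < (1 - x) ^ 2 := (Real.sqrt_lt' (by linarith)).1 (by linarith)
    refine eventually_le_minimaxError_of_lt_one (x := x) (z := 2 * x - 1) ha hβ hr hxr hx3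
      (by linarith) hx4 (by nlinarith) hn hs
  · have hβe : β = 1 := le_antisymm hβ1 (not_lt.1 h2)
    subst hβe
    exact eventually_le_minimaxError_of_one ha hr hrb hn hs

/-! ### Gaussian tails and projected rows -/

/-- The standard Gaussian upper tail. -/
def gaussianTail (x : ℝ) : ℝ := (gaussianReal 0 1).real (Set.Ioi x)

lemma gaussianTail_nonneg (x : ℝ) : 0 ≤ gaussianTail x := measureReal_nonneg

lemma gaussianTail_antitone : Antitone gaussianTail := fun _ _ h =>
  measureReal_mono (Set.Ioi_subset_Ioi h) (measure_ne_top _ _)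

lemma gaussianReal_real_Ioi (m τ : ℝ) :
    (gaussianReal m 1).real (Set.Ioi τ) = gaussianTail (τ - m) := by
  have h := gaussianReal_map_const_add (μ := 0) (v := 1) m
  rw [zero_add] at h
  rw [← h, map_measureReal_apply (by fun_prop) measurableSet_Ioi, gaussianTail]
  congr 1
  ext x
  simp [sub_lt_iff_lt_add']

lemma gaussianTail_le {x : ℝ} (hx : 0 ≤ x) : gaussianTail x ≤ Real.exp (-x ^ 2 / 2) := by
  have h := measure_ge_le_exp_mul_mgf (X := fun y => y) (μ := gaussianReal 0 1) x hx
    (integrable_exp_mul_gaussianReal x)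
  rw [mgf_fun_id_gaussianReal] at h
  simp only [← Real.exp_add] at h
  refine (measureReal_mono (s₂ := {y | x ≤ y}) (fun y (hy : x < y) => hy.le)
    (measure_ne_top _ _)).trans (h.trans_eq ?_)
  congr 1; simp; ring

/-- The density is integrated over an interval of length 1 and bounded by its value at the right
end. The loss does not affect exponents of p. -/
lemma le_gaussianTail {x : ℝ} (hx : 0 ≤ x) :
    (√(2 * Real.pi))⁻¹ * Real.exp (-(x + 1) ^ 2 / 2) ≤ gaussianTail x := by
  have h1 : (gaussianReal 0 1).real (Set.Ioc x (x + 1)) ≤ gaussianTail x :=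
    measureReal_mono (fun y hy => hy.1) (measure_ne_top _ _)
  refine le_trans ?_ h1
  rw [measureReal_def, gaussianReal_apply_eq_integral 0 one_ne_zero,
    ENNReal.toReal_ofReal (integral_nonneg fun _ => gaussianPDFReal_nonneg _ _ _)]
  have h2 : ∫ _ in Set.Ioc x (x + 1), (√(2 * Real.pi))⁻¹ * Real.exp (-(x + 1) ^ 2 / 2)
      ≤ ∫ y in Set.Ioc x (x + 1), gaussianPDFReal 0 1 y := by
    refine setIntegral_mono_on (integrableOn_const measure_Ioc_lt_top.ne)
      (integrable_gaussianPDFReal 0 1).integrableOn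
      measurableSet_Ioc fun y hy => ?_
    simp only [gaussianPDFReal, NNReal.coe_one, mul_one, sub_zero]
    refine mul_le_mul_of_nonneg_left (Real.exp_le_exp.2 ?_) (by positivity)
    have : y ^ 2 ≤ (x + 1) ^ 2 := pow_le_pow_left₀ (hx.trans hy.1.le) hy.2 2
    linarith
  simpa using h2

/-- A linear combination with unit coefficient vector of independent Gaussians of variance one. -/
lemma pi_gaussianReal_map_sum {n : ℕ} (m w : Fin n → ℝ) (hw : ∑ i, w i * w i = 1) :
    (Measure.pi fun i => gaussianReal (m i) 1).map (fun x => ∑ i, w i * x i)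
      = gaussianReal (∑ i, w i * m i) 1 := by
  have hmeas : Measurable fun x : Fin n → ℝ => ∑ i, w i * x i := by fun_prop
  have : IsProbabilityMeasure ((Measure.pi fun i => gaussianReal (m i) 1).map
    (fun x => ∑ i, w i * x i)) := Measure.isProbabilityMeasure_map hmeas.aemeasurable
  refine Measure.ext_of_charFun ?_
  ext t
  rw [charFun_apply_real, integral_map hmeas.aemeasurable (by fun_prop), charFun_gaussianReal]
  have h1 : ∀ x : Fin n → ℝ, Complex.exp (t * ((∑ i, w i * x i : ℝ) : ℂ) * Complex.I)
      = ∏ i, Complex.exp (((t * w i : ℝ) : ℂ) * (x i : ℂ) * Complex.I) := by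
    intro x
    rw [← Complex.exp_sum]
    congr 1
    push_cast
    rw [Finset.mul_sum, Finset.sum_mul]
    exact Finset.sum_congr rfl fun i _ => by ring
  simp_rw [h1]
  rw [integral_fintype_prod_eq_prod
    (fun i (y : ℝ) => Complex.exp (((t * w i : ℝ) : ℂ) * (y : ℂ) * Complex.I))]
  simp_rw [← charFun_apply_real, charFun_gaussianReal]
  rw [← Complex.exp_sum]
  congr 1
  rw [Finset.sum_sub_distrib]
  congr 1
  · push_cast
    rw [Finset.mul_sum, Finset.sum_mul]
    exact Finset.sum_congr rfl fun i _ => by ring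
  · have h2 : (∑ i, (w i : ℂ) * w i) = 1 := by exact_mod_cast congrArg (fun r : ℝ => (r : ℂ)) hw
    rw [← Finset.sum_div]
    congr 1
    calc _ = (∑ i, (w i : ℂ) * w i) * (t : ℂ) ^ 2 := by
          rw [Finset.sum_mul]
          refine Finset.sum_congr rfl fun i _ => ?_
          push_cast; ring
      _ = _ := by rw [h2]; push_cast; ring

/-- Projection on one unit direction reduces the matrix to p independent unit-variance Gaussians. -/
lemma law_map_rows {p n : ℕ} (θ : Fin p → Fin n → ℝ) (w : Fin n → ℝ) (hw : ∑ i, w i * w i = 1) :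
    (law θ).map (fun x j => ∑ i, w i * x j i)
      = Measure.pi fun j => gaussianReal (∑ i, w i * θ j i) 1 := by
  have hmeas : Measurable fun x : Fin n → ℝ => ∑ i, w i * x i := by fun_prop
  have hs : ∀ j, SigmaFinite ((Measure.pi fun i => gaussianReal (θ j i) 1).map
      (fun x => ∑ i, w i * x i)) := fun j => by
    rw [pi_gaussianReal_map_sum _ _ hw]; infer_instance
  have h := Measure.pi_map_pi (μ := fun j => Measure.pi fun i => gaussianReal (θ j i) 1)
    (f := fun _ x => ∑ i, w i * x i) (fun _ => hmeas.aemeasurable)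
  simp_rw [pi_gaussianReal_map_sum _ _ hw] at h
  exact h

/-! ### Exceedance counts -/

/-- The number of rows whose statistic in direction `w` exceeds `τ`. -/
def exceedCount {p n : ℕ} (w : Fin n → ℝ) (τ : ℝ) (x : Fin p → Fin n → ℝ) : ℝ :=
  ∑ j, (Set.Ioi τ).indicator (fun _ => (1 : ℝ)) (∑ i, w i * x j i)

lemma measurable_exceedCount {p n : ℕ} (w : Fin n → ℝ) (τ : ℝ) :
    Measurable (exceedCount (p := p) w τ) := by
  refine Finset.measurable_sum _ fun j _ => ?_
  exact (measurable_const.indicator measurableSet_Ioi).comp (by fun_prop)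

lemma exceedCount_nonneg {p n : ℕ} (w : Fin n → ℝ) (τ : ℝ) (x : Fin p → Fin n → ℝ) :
    0 ≤ exceedCount w τ x :=
  Finset.sum_nonneg fun _ _ => Set.indicator_nonneg (fun _ _ => zero_le_one) _

lemma exceedCount_le {p n : ℕ} (w : Fin n → ℝ) (τ : ℝ) (x : Fin p → Fin n → ℝ) :
    exceedCount w τ x ≤ p := by
  have : exceedCount w τ x ≤ ∑ _j : Fin p, (1 : ℝ) :=
    Finset.sum_le_sum fun _ _ => Set.indicator_le_self' (fun _ _ => zero_le_one) _
  simpa using this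

lemma integrable_exp_mul_exceedCount {p n : ℕ} (w : Fin n → ℝ) (τ l : ℝ)
    (P : Measure (Fin p → Fin n → ℝ)) [IsProbabilityMeasure P] :
    Integrable (fun x => Real.exp (l * exceedCount w τ x)) P := by
  refine Integrable.of_bound (((measurable_exceedCount w τ).const_mul l).exp.aestronglyMeasurable)
    (Real.exp (|l| * p)) (Eventually.of_forall fun x => ?_)
  rw [Real.norm_of_nonneg (Real.exp_pos _).le]
  refine Real.exp_le_exp.2 ((mul_le_mul_of_nonneg_right (le_abs_self l)
    (exceedCount_nonneg w τ x)).trans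
    (mul_le_mul_of_nonneg_left (exceedCount_le w τ x) (abs_nonneg l)))

/-- The count is a sum of independent Bernoulli variables, and 1 + u ≤ e^u gives the Poisson bound.
It holds for both signs of `l`, hence serves both tails. -/
lemma mgf_exceedCount_le {p n : ℕ} (θ : Fin p → Fin n → ℝ) (w : Fin n → ℝ)
    (hw : ∑ i, w i * w i = 1) (τ l : ℝ) :
    mgf (exceedCount w τ) (law θ) l
      ≤ Real.exp ((Real.exp l - 1) * ∑ j, gaussianTail (τ - ∑ i, w i * θ j i)) := by
  set I : ℝ → ℝ := (Set.Ioi τ).indicator (fun _ => (1 : ℝ)) with hI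
  have hIm : Measurable I := measurable_const.indicator measurableSet_Ioi
  have hrow : Measurable fun (x : Fin p → Fin n → ℝ) (j : Fin p) => ∑ i, w i * x j i := by fun_prop
  have h1 : mgf (exceedCount w τ) (law θ) l = ∏ j, ∫ y, Real.exp (l * I y)
      ∂(gaussianReal (∑ i, w i * θ j i) 1) := by
    rw [← integral_fintype_prod_eq_prod (fun (_ : Fin p) (y : ℝ) => Real.exp (l * I y)),
      ← law_map_rows θ w hw, integral_map hrow.aemeasurable
        (Measurable.aestronglyMeasurable (by fun_prop)), mgf]
    refine integral_congr_ae (Eventually.of_forall fun x => ?_)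
    dsimp only
    rw [← Real.exp_sum, ← Finset.mul_sum]
    rfl
  have h2 : ∀ m, ∫ y, Real.exp (l * I y) ∂(gaussianReal m 1)
      = 1 + (Real.exp l - 1) * gaussianTail (τ - m) := by
    intro m
    have e : ∀ y, Real.exp (l * I y)
        = 1 + (Real.exp l - 1) * (Set.Ioi τ).indicator (1 : ℝ → ℝ) y := by
      intro y
      by_cases hy : y ∈ Set.Ioi τ <;> simp [hI, hy]
    have hi : Integrable ((Set.Ioi τ).indicator (1 : ℝ → ℝ)) (gaussianReal m 1) :=
      (integrable_const (1 : ℝ)).indicator measurableSet_Ioi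
    simp_rw [e]
    rw [integral_add (integrable_const _) (hi.const_mul _), integral_const_mul,
      integral_indicator_one measurableSet_Ioi, gaussianReal_real_Ioi]
    simp
  rw [h1, Finset.mul_sum, Real.exp_sum]
  refine Finset.prod_le_prod (fun j _ => integral_nonneg fun _ => (Real.exp_pos _).le)
    fun j _ => ?_
  rw [h2, add_comm]
  exact Real.add_one_le_exp _

lemma law_real_exceedCount_ge_le {p n : ℕ} (θ : Fin p → Fin n → ℝ) (w : Fin n → ℝ)
    (hw : ∑ i, w i * w i = 1) (τ κ : ℝ) {l : ℝ} (hl : 0 ≤ l) :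
    (law θ).real {x | κ ≤ exceedCount w τ x}
      ≤ Real.exp (-l * κ + (Real.exp l - 1) * ∑ j, gaussianTail (τ - ∑ i, w i * θ j i)) := by
  rw [Real.exp_add]
  exact (measure_ge_le_exp_mul_mgf κ hl (integrable_exp_mul_exceedCount w τ l _)).trans
    (mul_le_mul_of_nonneg_left (mgf_exceedCount_le θ w hw τ l) (Real.exp_pos _).le)

lemma law_real_exceedCount_lt_le {p n : ℕ} (θ : Fin p → Fin n → ℝ) (w : Fin n → ℝ)
    (hw : ∑ i, w i * w i = 1) (τ κ : ℝ) {l : ℝ} (hl : l ≤ 0) :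
    (law θ).real {x | exceedCount w τ x < κ}
      ≤ Real.exp (-l * κ + (Real.exp l - 1) * ∑ j, gaussianTail (τ - ∑ i, w i * θ j i)) := by
  rw [Real.exp_add]
  refine (measureReal_mono (fun x (hx : _ < κ) => ?_) (measure_ne_top _ _)).trans
    ((measure_le_le_exp_mul_mgf κ hl (integrable_exp_mul_exceedCount w τ l _)).trans
    (mul_le_mul_of_nonneg_left (mgf_exceedCount_le θ w hw τ l) (Real.exp_pos _).le))
  exact hx.le

/-! ### Contrasts and the grid of changepoints -/

/-- The unit contrast between the first `t` and the last `n - t` coordinates. -/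
def contrast (n t : ℕ) : Fin n → ℝ := fun i =>
  √((t : ℝ) * ((n : ℝ) - t) / n) * if (i : ℕ) < t then 1 / (t : ℝ) else -(1 / ((n : ℝ) - t))

lemma sum_ite_val_lt {n t : ℕ} (htn : t ≤ n) (a b : ℝ) :
    ∑ i : Fin n, (if (i : ℕ) < t then a else b) = t * a + ((n : ℝ) - t) * b := by
  have hc : (Finset.univ.filter fun i : Fin n => (i : ℕ) < t).card = t := by
    rw [Fin.card_filter_val_lt]; omega
  have h : ∀ i : Fin n, (if (i : ℕ) < t then a else b)
      = b + if (i : ℕ) < t then a - b else 0 := by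
    intro i; split_ifs <;> ring
  rw [Finset.sum_congr rfl fun i _ => h i, Finset.sum_add_distrib, ← Finset.sum_filter,
    Finset.sum_const, Finset.sum_const, hc]
  simp; ring

lemma sum_contrast {n t : ℕ} (h1 : 1 ≤ t) (htn : t < n) : ∑ i, contrast n t i = 0 := by
  have h1' : (0 : ℝ) < t := by exact_mod_cast h1
  have h2 : (0 : ℝ) < (n : ℝ) - t := sub_pos.2 (by exact_mod_cast htn)
  unfold contrast
  rw [← Finset.mul_sum, sum_ite_val_lt htn.le]
  field_simp; ring

lemma sum_contrast_mul_self {n t : ℕ} (h1 : 1 ≤ t) (htn : t < n) :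
    ∑ i, contrast n t i * contrast n t i = 1 := by
  have h1' : (0 : ℝ) < t := by exact_mod_cast h1
  have h2 : (0 : ℝ) < (n : ℝ) - t := sub_pos.2 (by exact_mod_cast htn)
  have h3 : (0 : ℝ) < n := by linarith
  have e : ∀ i : Fin n, contrast n t i * contrast n t i
      = (t : ℝ) * ((n : ℝ) - t) / n
        * if (i : ℕ) < t then (1 / (t : ℝ)) ^ 2 else (1 / ((n : ℝ) - t)) ^ 2 := by
    intro i
    unfold contrast
    rw [mul_mul_mul_comm, Real.mul_self_sqrt (by positivity)]
    split_ifs <;> ring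
  rw [Finset.sum_congr rfl fun i _ => e i, ← Finset.mul_sum, sum_ite_val_lt htn.le]
  field_simp; ring

/-- The mean of the contrast at `t` of a step at `t'`. -/
lemma sum_contrast_mul_step {n t t' : ℕ} (h1 : 1 ≤ t) (htn : t < n) (htn' : t' ≤ n) (a b : ℝ) :
    ∑ i, contrast n t i * (if (i : ℕ) < t' then a else b)
      = √((t : ℝ) * ((n : ℝ) - t) / n) *
        (if t' ≤ t then (t' : ℝ) / t else ((n : ℝ) - t') / ((n : ℝ) - t)) * (a - b) := by
  have h1' : (0 : ℝ) < t := by exact_mod_cast h1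
  have h2 : (0 : ℝ) < (n : ℝ) - t := sub_pos.2 (by exact_mod_cast htn)
  have e : ∀ i : Fin n, contrast n t i * (if (i : ℕ) < t' then a else b)
      = contrast n t i * b + √((t : ℝ) * ((n : ℝ) - t) / n) * (a - b) *
        if (i : ℕ) < t' then
          (if (i : ℕ) < t then 1 / (t : ℝ) else -(1 / ((n : ℝ) - t))) else 0 := by
    intro i
    unfold contrast
    split_ifs <;> ring
  rw [Finset.sum_congr rfl fun i _ => e i, Finset.sum_add_distrib, ← Finset.sum_mul,
    sum_contrast h1 htn, zero_mul, zero_add, ← Finset.mul_sum]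
  have h3 : ∑ i : Fin n, (if (i : ℕ) < t' then
      (if (i : ℕ) < t then 1 / (t : ℝ) else -(1 / ((n : ℝ) - t))) else 0)
      = if t' ≤ t then (t' : ℝ) / t else ((n : ℝ) - t') / ((n : ℝ) - t) := by
    split_ifs with h
    · have : ∀ i : Fin n, (if (i : ℕ) < t' then
          (if (i : ℕ) < t then 1 / (t : ℝ) else -(1 / ((n : ℝ) - t))) else 0)
          = if (i : ℕ) < t' then 1 / (t : ℝ) else 0 := by
        intro i
        by_cases hi : (i : ℕ) < t'
        · simp [hi, hi.trans_le h]
        · simp [hi]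
      rw [Finset.sum_congr rfl fun i _ => this i, sum_ite_val_lt htn']
      field_simp; ring
    · have : ∀ i : Fin n, (if (i : ℕ) < t' then
          (if (i : ℕ) < t then 1 / (t : ℝ) else -(1 / ((n : ℝ) - t))) else 0)
          = (if (i : ℕ) < t then 1 / (t : ℝ) + 1 / ((n : ℝ) - t) else 0)
            + if (i : ℕ) < t' then -(1 / ((n : ℝ) - t)) else 0 := by
        intro i
        by_cases hi : (i : ℕ) < t
        · simp [hi, hi.trans (not_le.1 h)]
        · simp [hi]
      rw [Finset.sum_congr rfl fun i _ => this i, Finset.sum_add_distrib,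
        sum_ite_val_lt htn.le, sum_ite_val_lt htn']
      field_simp; ring
  rw [h3]; ring

/-- After squaring, everything cancels except the odds ratio in `hγ`. The statement covers t' ≤ t;
exchanging t with n - t gives the other side. -/
lemma mul_sqrt_le_sqrt_mul {t t' u u' n γ : ℝ} (ht : 0 < t) (ht' : 0 < t') (hu : 0 < u)
    (hu' : 0 < u') (hn : 0 < n) (hγ : γ ^ 2 ≤ t' * u / (t * u')) :
    γ * √(t' * u' / n) ≤ √(t * u / n) * (t' / t) := by
  refine (le_abs_self _).trans (abs_le_of_sq_le_sq ?_ (by positivity))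
  rw [mul_pow, mul_pow, Real.sq_sqrt (by positivity), Real.sq_sqrt (by positivity)]
  refine (mul_le_mul_of_nonneg_right hγ (by positivity)).trans_eq ?_
  field_simp

lemma le_sum_contrast_mul_step {n t t' : ℕ} (h1 : 1 ≤ t) (htn : t < n) (h1' : 1 ≤ t')
    (htn' : t' < n) {γ ρ a b : ℝ} (hγ0 : 0 ≤ γ) (hρ : 0 ≤ ρ)
    (hγ : γ ^ 2 ≤ (t' : ℝ) * ((n : ℝ) - t) / (t * ((n : ℝ) - t')))
    (hγ' : γ ^ 2 ≤ (t : ℝ) * ((n : ℝ) - t') / (t' * ((n : ℝ) - t)))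
    (hab : ρ ≤ √((t' : ℝ) * ((n : ℝ) - t') / n) * (a - b)) :
    γ * ρ ≤ ∑ i, contrast n t i * (if (i : ℕ) < t' then a else b) := by
  have ht : (0 : ℝ) < t := by exact_mod_cast h1
  have ht' : (0 : ℝ) < t' := by exact_mod_cast h1'
  have hu : (0 : ℝ) < (n : ℝ) - t := sub_pos.2 (by exact_mod_cast htn)
  have hu' : (0 : ℝ) < (n : ℝ) - t' := sub_pos.2 (by exact_mod_cast htn')
  have hn : (0 : ℝ) < n := by linarith
  have hs : 0 < √((t' : ℝ) * ((n : ℝ) - t') / n) := Real.sqrt_pos.2 (by positivity)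
  have hab0 : 0 ≤ a - b := nonneg_of_mul_nonneg_right (hρ.trans hab) hs
  rw [sum_contrast_mul_step h1 htn htn'.le]
  have key : γ * √((t' : ℝ) * ((n : ℝ) - t') / n) ≤ √((t : ℝ) * ((n : ℝ) - t) / n) *
      (if t' ≤ t then (t' : ℝ) / t else ((n : ℝ) - t') / ((n : ℝ) - t)) := by
    split_ifs
    · exact mul_sqrt_le_sqrt_mul ht ht' hu hu' hn hγ
    · have := mul_sqrt_le_sqrt_mul hu hu' ht ht' hn (γ := γ)
        (by rwa [mul_comm ((n : ℝ) - t'), mul_comm ((n : ℝ) - t)])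
      rwa [mul_comm ((n : ℝ) - t'), mul_comm ((n : ℝ) - t)] at this
  calc γ * ρ ≤ γ * (√((t' : ℝ) * ((n : ℝ) - t') / n) * (a - b)) :=
        mul_le_mul_of_nonneg_left hab hγ0
    _ = γ * √((t' : ℝ) * ((n : ℝ) - t') / n) * (a - b) := by ring
    _ ≤ _ := mul_le_mul_of_nonneg_right key hab0

/-- A grid of `O(log n)` changepoints such that every changepoint has odds `t / (n - t)` within a
constant factor of those of a grid point. -/
lemma exists_grid {n : ℕ} {γ : ℝ} (hγ0 : 0 < γ) (hγ1 : γ < 1) :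
    ∃ T : Finset ℕ, (∀ t ∈ T, 1 ≤ t ∧ t < n) ∧
      (T.card : ℝ) ≤ 2 + Real.log n / -Real.log γ ∧
      ∀ t', 1 ≤ t' → t' < n → ∃ t ∈ T,
        γ ^ 2 ≤ (t' : ℝ) * ((n : ℝ) - t) / (t * ((n : ℝ) - t')) ∧
        γ ^ 2 ≤ (t : ℝ) * ((n : ℝ) - t') / (t' * ((n : ℝ) - t)) := by
  -- Changepoints are binned by log-odds in cells of width `η`; within a cell the odds differ by a
  -- factor less than γ^(-2).
  set η : ℝ := -(2 * Real.log γ) with hη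
  have hlγ : Real.log γ < 0 := Real.log_neg hγ0 hγ1
  have hη0 : 0 < η := by rw [hη]; linarith
  set lo : ℕ → ℝ := fun t => Real.log t - Real.log ((n : ℝ) - t) with hlo
  set s : Finset ℕ := Finset.Ico 1 n with hs
  set b : ℕ → ℤ := fun t => ⌊lo t / η⌋ with hb
  have hlob : ∀ t ∈ s, -Real.log n ≤ lo t ∧ lo t ≤ Real.log n := by
    intro t ht
    rw [hs, Finset.mem_Ico] at ht
    have h1 : (1 : ℝ) ≤ t := by exact_mod_cast ht.1
    have h2 : (1 : ℝ) ≤ (n : ℝ) - t := by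
      have : ((t + 1 : ℕ) : ℝ) ≤ n := by exact_mod_cast ht.2
      push_cast at this; linarith
    have e1 := Real.log_nonneg h1
    have e2 := Real.log_nonneg h2
    have e3 : Real.log t ≤ Real.log n := Real.log_le_log (by linarith) (by linarith)
    have e4 : Real.log ((n : ℝ) - t) ≤ Real.log n := Real.log_le_log (by linarith) (by linarith)
    constructor <;> simp only [hlo] <;> linarith
  have hsub : s.image b ⊆ Finset.Icc ⌊-Real.log n / η⌋ ⌊Real.log n / η⌋ := by
    intro k hk
    rw [Finset.mem_image] at hk
    obtain ⟨t, ht, rfl⟩ := hk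
    rw [Finset.mem_Icc]
    exact ⟨Int.floor_le_floor (div_le_div_of_nonneg_right (hlob t ht).1 hη0.le),
      Int.floor_le_floor (div_le_div_of_nonneg_right (hlob t ht).2 hη0.le)⟩
  -- `Function.invFunOn` picks one representative from each nonempty cell.
  have hinv : ∀ k ∈ s.image b, Function.invFunOn b s k ∈ s ∧ b (Function.invFunOn b s k) = k := by
    intro k hk
    rw [Finset.mem_image] at hk
    exact ⟨Function.invFunOn_mem hk, Function.invFunOn_eq hk⟩
  refine ⟨(s.image b).image (Function.invFunOn b s), ?_, ?_, ?_⟩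
  · intro t ht
    rw [Finset.mem_image] at ht
    obtain ⟨k, hk, rfl⟩ := ht
    exact Finset.mem_Ico.1 (hinv k hk).1
  · have h1 : ((s.image b).image (Function.invFunOn b s)).card
        ≤ (⌊Real.log n / η⌋ + 1 - ⌊-Real.log n / η⌋).toNat := by
      rw [← Int.card_Icc]
      exact Finset.card_image_le.trans (Finset.card_le_card hsub)
    have hln : 0 ≤ Real.log n / η := div_nonneg (Real.log_natCast_nonneg n) hη0.le
    have h2 : ⌊-Real.log n / η⌋ ≤ ⌊Real.log n / η⌋ := Int.floor_le_floor (by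
      rw [neg_div]; linarith)
    have h3 : (((⌊Real.log n / η⌋ + 1 - ⌊-Real.log n / η⌋).toNat : ℤ) : ℝ)
        = ⌊Real.log n / η⌋ + 1 - ⌊-Real.log n / η⌋ := by
      rw [Int.toNat_of_nonneg (by omega)]; push_cast; ring
    have h4 : (((s.image b).image (Function.invFunOn b s)).card : ℝ)
        ≤ ⌊Real.log n / η⌋ + 1 - ⌊-Real.log n / η⌋ := by
      rw [← h3, Int.cast_natCast]; exact_mod_cast h1
    have h5 := Int.floor_le (Real.log n / η)
    have h6 := Int.lt_floor_add_one (-Real.log n / η)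
    rw [neg_div] at h6
    have e : Real.log n / -Real.log γ = 2 * (Real.log n / η) := by
      rw [hη]; field_simp
    rw [e]
    rw [neg_div] at h4
    linarith
  · intro t' h1' htn'
    have ht's : t' ∈ s := Finset.mem_Ico.2 ⟨h1', htn'⟩
    obtain ⟨hm, he⟩ := hinv (b t') (Finset.mem_image_of_mem b ht's)
    refine ⟨_, Finset.mem_image_of_mem _ (Finset.mem_image_of_mem b ht's), ?_⟩
    set t := Function.invFunOn b s (b t')
    obtain ⟨h1, htn⟩ := Finset.mem_Ico.1 hm
    have habs : |lo t / η - lo t' / η| < 1 := Int.abs_sub_lt_one_of_floor_eq_floor he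
    rw [← sub_div, abs_div, abs_of_pos hη0, div_lt_one hη0, abs_lt] at habs
    have ht : (0 : ℝ) < t := by exact_mod_cast h1
    have ht' : (0 : ℝ) < t' := by exact_mod_cast h1'
    have hu : (0 : ℝ) < (n : ℝ) - t := sub_pos.2 (by exact_mod_cast htn)
    have hu' : (0 : ℝ) < (n : ℝ) - t' := sub_pos.2 (by exact_mod_cast htn')
    have hl : ∀ c d e f : ℝ, 0 < c → 0 < d → 0 < e → 0 < f →
        -η ≤ Real.log c + Real.log d - (Real.log e + Real.log f) →
        γ ^ 2 ≤ c * d / (e * f) := by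
      intro c d e f hc hd he hf h
      rw [← Real.log_le_log_iff (by positivity) (by positivity), Real.log_pow,
        Real.log_div (by positivity) (by positivity), Real.log_mul hc.ne' hd.ne',
        Real.log_mul he.ne' hf.ne']
      rw [hη] at h
      push_cast
      linarith
    simp only [hlo] at habs
    exact ⟨hl _ _ _ _ ht' hu ht hu' (by linarith), hl _ _ _ _ ht hu' ht' hu (by linarith)⟩

/-! ### Errors of the scan test -/

/-- The scan test that rejects when the number of exceedances at some grid point is at least
`κ`. -/
lemma minimaxError_le_of_scan {p n s : ℕ} {ρ τ κ B₁ B₂ : ℝ} (T : Finset ℕ) (hB₁ : 0 ≤ B₁)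
    (hB₂ : 0 ≤ B₂)
    (hnull : ∀ θ ∈ nullSpace p n, ∀ t ∈ T,
      (law θ).real {x | κ ≤ exceedCount (contrast n t) τ x} ≤ B₁)
    (halt : ∀ θ ∈ altSpace p n ρ s, ∃ t ∈ T,
      (law θ).real {x | exceedCount (contrast n t) τ x < κ} ≤ B₂) :
    minimaxError p n ρ s ≤ T.card * B₁ + B₂ := by
  set R : Set (Fin p → Fin n → ℝ) := ⋃ t ∈ T, {x | κ ≤ exceedCount (contrast n t) τ x} with hR
  have hRm : MeasurableSet R := Finset.measurableSet_biUnion _ fun t _ =>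
    measurableSet_le measurable_const (measurable_exceedCount _ _)
  have hψ : R.indicator (1 : (Fin p → Fin n → ℝ) → ℝ) ∈ tests p n := by
    refine ⟨measurable_one.indicator hRm, fun x => ?_⟩
    by_cases hx : x ∈ R <;> simp [hx]
  refine minimaxError_le hψ (by positivity) hB₂ (fun θ hθ => ?_) (fun θ hθ => ?_)
  · rw [integral_indicator_one hRm]
    refine (measureReal_biUnion_finset_le _ _).trans ?_
    rw [← nsmul_eq_mul]
    exact Finset.sum_le_card_nsmul _ _ _ fun t ht => hnull θ hθ t ht
  · obtain ⟨t, ht, h⟩ := halt θ hθ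
    rw [integral_sub (integrable_const _) (integrable_test hψ _), integral_indicator_one hRm]
    simp only [integral_const, probReal_univ, smul_eq_mul, mul_one]
    rw [← probReal_compl_eq_one_sub hRm]
    refine (measureReal_mono (fun x hx => ?_) (measure_ne_top _ _)).trans h
    simp only [hR, Set.mem_compl_iff, Set.mem_iUnion, not_exists] at hx
    have hx' : ¬κ ≤ exceedCount (contrast n t) τ x := hx t ht
    exact not_le.1 hx'

lemma sum_contrast_mul_of_mem_nullSpace {p n t : ℕ} (h1 : 1 ≤ t) (htn : t < n)
    {θ : Fin p → Fin n → ℝ} (hθ : θ ∈ nullSpace p n) (j : Fin p) :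
    ∑ i, contrast n t i * θ j i = 0 := by
  obtain ⟨μ, hμ⟩ := hθ
  simp_rw [hμ]
  rw [← Finset.sum_mul, sum_contrast h1 htn, zero_mul]

/-- The mean vector of the row contrasts at a suitable grid point, for alternatives. -/
lemma exists_grid_mean_le {n : ℕ} {γ : ℝ} (hγ0 : 0 < γ) (hγ1 : γ < 1) :
    ∃ T : Finset ℕ, (∀ t ∈ T, 1 ≤ t ∧ t < n) ∧
      (T.card : ℝ) ≤ 2 + Real.log n / -Real.log γ ∧
      ∀ (p s : ℕ) (ρ : ℝ), 0 ≤ ρ → ∀ θ ∈ altSpace p n ρ s, ∃ t ∈ T, ∃ S : Finset (Fin p),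
        s ≤ S.card ∧ (∀ j ∈ S, γ * ρ ≤ ∑ i, contrast n t i * θ j i) ∧
        ∀ j ∉ S, ∑ i, contrast n t i * θ j i = 0 := by
  obtain ⟨T, hT, hcard, hgrid⟩ := exists_grid (n := n) hγ0 hγ1
  refine ⟨T, hT, hcard, fun p s ρ hρ θ hθ => ?_⟩
  obtain ⟨S, μ₁, μ₂, t', hS, h1', htn', hmem, hnot, hθ⟩ := hθ
  obtain ⟨t, ht, hg1, hg2⟩ := hgrid t' h1' htn'
  obtain ⟨h1, htn⟩ := hT t ht
  refine ⟨t, ht, S, hS, fun j hj => ?_, fun j hj => ?_⟩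
  · simp_rw [hθ]
    exact le_sum_contrast_mul_step h1 htn h1' htn' hγ0.le hρ hg1 hg2 (hmem j hj)
  · simp_rw [hθ]
    rw [sum_contrast_mul_step h1 htn htn'.le, hnot j hj, sub_self, mul_zero]

/-- Chernoff with e^l - 1 ≤ l + l²: the quadratic term costs at most 1 by `hlp`, so 1/l acts as the
standard deviation of the count. -/
lemma law_real_exceedCount_ge_le_of_null {p n : ℕ} {θ : Fin p → Fin n → ℝ} {w : Fin n → ℝ}
    (hw : ∑ i, w i * w i = 1) (hθ : ∀ j, ∑ i, w i * θ j i = 0) {τ l X : ℝ} (hl0 : 0 ≤ l)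
    (hl1 : l ≤ 1) (hlp : l ^ 2 * (p * gaussianTail τ) ≤ 1) :
    (law θ).real {x | p * gaussianTail τ + X ≤ exceedCount w τ x} ≤ Real.exp (1 - l * X) := by
  refine (law_real_exceedCount_ge_le θ w hw τ _ hl0).trans (Real.exp_le_exp.2 ?_)
  simp only [hθ, sub_zero, Finset.sum_const, Finset.card_univ, Fintype.card_fin, nsmul_eq_mul]
  have h1 : Real.exp l - 1 ≤ l + l ^ 2 := by
    have := (abs_le.1 (Real.abs_exp_sub_one_sub_id_le (abs_le.2 ⟨by linarith, hl1⟩))).2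
    linarith
  have h2 : 0 ≤ p * gaussianTail τ := mul_nonneg (Nat.cast_nonneg p) (gaussianTail_nonneg τ)
  nlinarith [mul_le_mul_of_nonneg_right h1 h2]

/-- The planted rows raise the mean by at least `4X`. As `l ≤ 1/2`, the quadratic term spoils at
most half of this; of the remaining `2X`, one `X` pays for the threshold and the other gives the
bound. -/
lemma law_real_exceedCount_lt_le_of_alt {p n s : ℕ} {θ : Fin p → Fin n → ℝ} {w : Fin n → ℝ}
    (hw : ∑ i, w i * w i = 1) {S : Finset (Fin p)} (hS : s ≤ S.card) {τ l X m : ℝ}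
    (hmS : ∀ j ∈ S, m ≤ ∑ i, w i * θ j i) (hm : ∀ j ∉ S, ∑ i, w i * θ j i = 0) (hm0 : 0 ≤ m)
    (hl0 : 0 ≤ l) (hl1 : l ≤ 1 / 2) (hlp : l ^ 2 * (p * gaussianTail τ) ≤ 1)
    (hX0 : 0 ≤ X) (hX : 4 * X ≤ s * (gaussianTail (τ - m) - gaussianTail τ)) :
    (law θ).real {x | exceedCount w τ x < p * gaussianTail τ + X} ≤ Real.exp (1 - l * X) := by
  refine (law_real_exceedCount_lt_le θ w hw τ _ (neg_nonpos.2 hl0)).trans (Real.exp_le_exp.2 ?_)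
  set Q := gaussianTail τ
  set Q₁ := gaussianTail (τ - m)
  have hQ : Q ≤ Q₁ := gaussianTail_antitone (by linarith)
  set M := ∑ j, gaussianTail (τ - ∑ i, w i * θ j i) with hM
  have h1 : Real.exp (-l) - 1 ≤ -l + l ^ 2 := by
    have := (abs_le.1 (Real.abs_exp_sub_one_sub_id_le (x := -l)
      (abs_le.2 ⟨by linarith, by linarith⟩))).2
    linarith
  have h2 : p * Q + s * (Q₁ - Q) ≤ M := by
    have h3 : ∑ j, (Q + onSet S (Q₁ - Q) j) ≤ M := by
      refine Finset.sum_le_sum fun j _ => ?_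
      by_cases hj : j ∈ S
      · simp only [onSet, hj, if_true, add_sub_cancel]
        exact gaussianTail_antitone (by linarith [hmS j hj])
      · simp only [onSet, hj, if_false, add_zero, hm j hj, sub_zero]
        exact le_rfl
    have h4 : ∑ j, (Q + onSet S (Q₁ - Q) j) = p * Q + S.card * (Q₁ - Q) := by
      rw [Finset.sum_add_distrib]
      simp [onSet, Finset.sum_ite_mem]
      ring
    have h5 : (s : ℝ) * (Q₁ - Q) ≤ S.card * (Q₁ - Q) :=
      mul_le_mul_of_nonneg_right (by exact_mod_cast hS) (sub_nonneg.2 hQ)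
    linarith
  set D := (s : ℝ) * (Q₁ - Q)
  have h2' : 0 ≤ M - (p * Q + D) := sub_nonneg.2 h2
  have hM0 : 0 ≤ M := Finset.sum_nonneg fun _ _ => gaussianTail_nonneg _
  have h6 : (Real.exp (-l) - 1) * M ≤ (-l + l ^ 2) * (p * Q + D) := by
    have h7 := mul_le_mul_of_nonneg_right h1 hM0
    have h8 : 0 ≤ l - l ^ 2 := by nlinarith
    nlinarith [mul_nonneg h8 h2']
  have h9 : l * (1 - l) * D ≥ l * (1 / 2) * (4 * X) := by
    have hD : 0 ≤ D := by linarith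
    have h10 : l * (1 / 2) ≤ l * (1 - l) := mul_le_mul_of_nonneg_left (by linarith) hl0
    exact mul_le_mul h10 hX (by linarith) (by nlinarith)
  nlinarith

/-- A count below 1 is 0, which forces the single strong row `j` below its mean by at least `m - τ`.
-/
lemma law_real_exceedCount_lt_one_le {p n : ℕ} {θ : Fin p → Fin n → ℝ} {w : Fin n → ℝ}
    (hw : ∑ i, w i * w i = 1) {τ m : ℝ} {j : Fin p} (hτm : τ ≤ m) (hm : m ≤ ∑ i, w i * θ j i) :
    (law θ).real {x | exceedCount w τ x < 1} ≤ Real.exp (-(m - τ) ^ 2 / 2) := by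
  have hpair : ∀ x : Fin p → Fin n → ℝ,
      pair (rowMat (onSet {j} (-1)) w) x = -∑ i, w i * x j i := by
    intro x
    rw [pair_rowMat_left, sum_onSet_mul]; simp
  have hv : pair (rowMat (onSet {j} (-1)) w) (rowMat (onSet {j} (-1)) w) = 1 := by
    rw [pair_rowMat, sum_onSet_mul_onSet, hw]; simp
  have h := law_real_pair_ge_le _ θ hv (c := -τ) (by rw [hpair]; linarith)
  rw [hpair] at h
  refine (measureReal_mono (fun x (hx : exceedCount w τ x < 1) => ?_) (measure_ne_top _ _)).trans
    (h.trans (Real.exp_le_exp.2 ?_))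
  · have hle : ∑ i, w i * x j i ≤ τ := by
      by_contra hlt
      rw [not_le] at hlt
      have h1 : (Set.Ioi τ).indicator (fun _ => (1 : ℝ)) (∑ i, w i * x j i)
          ≤ exceedCount w τ x :=
        Finset.single_le_sum (f := fun j => (Set.Ioi τ).indicator (fun _ => (1 : ℝ))
          (∑ i, w i * x j i)) (fun _ _ => Set.indicator_nonneg (fun _ _ => zero_le_one) _)
          (Finset.mem_univ j)
      rw [Set.indicator_of_mem (Set.mem_Ioi.2 hlt)] at h1
      linarith
    show -τ ≤ pair (rowMat (onSet {j} (-1)) w) x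
    rw [hpair]; linarith
  · have : (m - τ) ^ 2 ≤ (-τ - -∑ i, w i * θ j i) ^ 2 :=
      pow_le_pow_left₀ (by linarith) (by linarith) 2
    linarith

/-! ### The upper bound in the asymptotic regime -/

lemma exp_neg_mul_sqrt_sq {p : ℕ} (hp : 0 < p) (y : ℝ) :
    Real.exp (-(y * √(2 * Real.log (p : ℝ))) ^ 2 / 2) = (p : ℝ) ^ (-y ^ 2) := by
  rw [← exp_mul_log_natCast hp, mul_pow, sqrt_two_mul_log_sq]
  congr 1; ring

lemma tendsto_sqrt_two_mul_log : Tendsto (fun p : ℕ => √(2 * Real.log (p : ℝ))) atTop atTop :=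
  Real.tendsto_sqrt_atTop.comp ((Real.tendsto_log_atTop.comp
    tendsto_natCast_atTop_atTop).const_mul_atTop zero_lt_two)

/-- Stretched-exponential errors absorb a grid of polynomial size, which is why `a` is absent from
the boundary for β < 1. -/
lemma tendsto_rpow_mul_exp_neg_rpow (b : ℝ) {c : ℝ} (hc : 0 < c) :
    Tendsto (fun p : ℕ => (p : ℝ) ^ b * Real.exp (-(p : ℝ) ^ c)) atTop (𝓝 0) := by
  have h := (tendsto_rpow_mul_exp_neg_mul_atTop_nhds_zero (b / c) 1 one_pos).comp
    (tendsto_rpow_natCast_atTop hc)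
  refine h.congr fun p => ?_
  rw [Function.comp, ← Real.rpow_mul (Nat.cast_nonneg p), mul_div_cancel₀ _ hc.ne', neg_one_mul]

lemma div_sqrt_mul_sqrt {r x : ℝ} (hr : 0 < r) (c : ℝ) :
    x / √r * √(2 * r * c) = x * √(2 * c) := by
  rw [mul_comm 2 r, mul_assoc, Real.sqrt_mul hr.le]
  have := (Real.sqrt_pos.2 hr).ne'
  field_simp

/-- `hxyβ` says that the excess of exceedances due to the planted rows has a larger exponent than
the noise standard deviation. `y < 1` makes that deviation grow. -/
lemma tendsto_minimaxError_of_exponents {a β r x y : ℝ} {n s : ℕ → ℕ} (ha : 0 < a)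
    (hr : 0 < r) (hx0 : 0 < x) (hx : x < √r) (hxy : x < y)
    (hxyβ : (1 - y ^ 2) / 2 < 1 - β - (y - x) ^ 2) (hy1 : y < 1)
    (hn : Tendsto (fun p : ℕ => Real.log (Real.log (n p : ℝ)) / (a * Real.log (p : ℝ)))
      atTop (𝓝 1))
    (hs : Tendsto (fun p : ℕ => (s p : ℝ) / (p : ℝ) ^ (1 - β)) atTop (𝓝 1)) :
    Tendsto (fun p : ℕ => minimaxError p (n p) (√(2 * r * Real.log (p : ℝ))) (s p))
      atTop (𝓝 0) := by
  have hy0 : 0 < y := hx0.trans hxy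
  have hsr : 0 < √r := hx0.trans hx
  -- This grid precision turns the signal √r into exactly `x`.
  set γ := x / √r with hγ
  have hγ0 : 0 < γ := div_pos hx0 hsr
  have hγ1 : γ < 1 := (div_lt_one hsr).2 hx
  have hγl : 0 < -Real.log γ := neg_pos.2 (Real.log_neg hγ0 hγ1)
  -- Taking `d > y - x` absorbs the shift by 1 in `le_gaussianTail`; `d < y` makes the null tail
  -- negligible beside the planted one.
  obtain ⟨d, hd1, hd2⟩ := exists_between (lt_min (by linarith : y - x < y)
    ((Real.lt_sqrt (sub_nonneg.2 hxy.le)).2 (by linarith :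
      (y - x) ^ 2 < 1 - β - (1 - y ^ 2) / 2)))
  have hd0 : 0 < d := (sub_pos.2 hxy).trans hd1
  have hdy := hd2.trans_le (min_le_left _ _)
  have hdβ := (Real.lt_sqrt hd0.le).1 (hd2.trans_le (min_le_right _ _))
  -- The margin is X = p^g and the Chernoff parameter l = p^(-h), so the errors are exp(1 -
  -- p^(g-h)).
  obtain ⟨g, hg1, hg2⟩ := exists_between (by linarith : (1 - y ^ 2) / 2 < 1 - β - d ^ 2)
  set h := (1 - y ^ 2) / 2 with hh
  have hh0 : 0 < h := by rw [hh]; nlinarith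
  set c := (√(2 * Real.pi))⁻¹ with hc
  have hc0 : 0 < c := by rw [hc]; have := Real.pi_pos; positivity
  have hgh : 0 < g - h := sub_pos.2 hg1
  have hlim : Tendsto (fun p : ℕ => Real.exp 1 * (3 * ((p : ℝ) ^ (0 : ℝ)
      * Real.exp (-(p : ℝ) ^ (g - h))) + (-Real.log γ)⁻¹ *
      ((p : ℝ) ^ (2 * a) * Real.exp (-(p : ℝ) ^ (g - h))))) atTop (𝓝 0) := by
    have := (((tendsto_rpow_mul_exp_neg_rpow 0 hgh).const_mul 3).add
      ((tendsto_rpow_mul_exp_neg_rpow (2 * a) hgh).const_mul (-Real.log γ)⁻¹)).const_mul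
      (Real.exp 1)
    simpa only [mul_zero, add_zero] using this
  refine tendsto_of_tendsto_of_tendsto_of_le_of_le' tendsto_const_nhds hlim
    (Eventually.of_forall fun p => minimaxError_nonneg _ _ _ _) ?_
  have hdelta : 0 < d - (y - x) := sub_pos.2 hd1
  filter_upwards [eventually_log_le_rpow ha hn (by linarith : a < 2 * a),
    eventually_le_sparsity hs, eventually_gt_atTop 0,
    (tendsto_sqrt_two_mul_log.const_mul_atTop hdelta).eventually_ge_atTop 1,
    (tendsto_const_mul_rpow_zero 1 (by nlinarith : d ^ 2 - y ^ 2 < 0)).eventually_le_const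
      (half_pos hc0),
    (tendsto_const_mul_rpow_zero 16 (by linarith : g - (1 - β - d ^ 2) < 0)).eventually_le_const
      hc0,
    (tendsto_const_mul_rpow_zero 1 (by linarith : -h < 0)).eventually_le_const
      (by norm_num : (0 : ℝ) < 1 / 2)] with p hlog hsp hp hL hF2 hF3 hF4
  have hp0 : (0 : ℝ) < p := by exact_mod_cast hp
  set L := √(2 * Real.log (p : ℝ)) with hLdef
  have hL0 : 0 ≤ L := Real.sqrt_nonneg _
  set Q := gaussianTail (y * L) with hQ
  set l := (p : ℝ) ^ (-h) with hl
  set X := (p : ℝ) ^ g with hX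
  rw [one_mul] at hF2 hF4
  have hX0 : 0 < X := by positivity
  have hl0 : 0 < l := by positivity
  have hQle : Q ≤ (p : ℝ) ^ (-y ^ 2) := by
    rw [← exp_neg_mul_sqrt_sq hp]
    exact gaussianTail_le (by positivity)
  have hlp : l ^ 2 * (p * Q) ≤ 1 := by
    have e : l ^ 2 * (p * (p : ℝ) ^ (-y ^ 2)) = 1 := by
      rw [hl, ← Real.rpow_natCast, ← Real.rpow_mul hp0.le, ← Real.rpow_one_add' hp0.le
        (by nlinarith), ← Real.rpow_add hp0, hh]
      have : -((1 - y ^ 2) / 2) * ((2 : ℕ) : ℝ) + (1 + -y ^ 2) = 0 := by push_cast; ring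
      rw [this, Real.rpow_zero]
    rw [← e]
    gcongr
  have hlX : l * X = (p : ℝ) ^ (g - h) := by
    rw [hl, hX, ← Real.rpow_add hp0]; congr 1; ring
  have hQ1 : c * (p : ℝ) ^ (-d ^ 2) ≤ gaussianTail (y * L - x * L) := by
    rw [← sub_mul]
    refine le_trans ?_ (le_gaussianTail (mul_nonneg (sub_nonneg.2 hxy.le) hL0))
    rw [← exp_neg_mul_sqrt_sq hp]
    refine mul_le_mul_of_nonneg_left (Real.exp_le_exp.2 ?_) hc0.le
    have : ((y - x) * L + 1) ^ 2 ≤ (d * L) ^ 2 :=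
      pow_le_pow_left₀ (add_nonneg (mul_nonneg (sub_nonneg.2 hxy.le) hL0) zero_le_one)
        (by linarith) 2
    linarith
  have hD : 4 * X ≤ s p * (gaussianTail (y * L - x * L) - Q) := by
    have e1 : (p : ℝ) ^ (-y ^ 2) = (p : ℝ) ^ (d ^ 2 - y ^ 2) * (p : ℝ) ^ (-d ^ 2) := by
      rw [← Real.rpow_add hp0]; congr 1; ring
    have e2 : X = (p : ℝ) ^ (g - (1 - β - d ^ 2)) * ((p : ℝ) ^ (1 - β) * (p : ℝ) ^ (-d ^ 2)) := by
      rw [hX, ← Real.rpow_add hp0, ← Real.rpow_add hp0]; congr 1; ring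
    have hpd : 0 < (p : ℝ) ^ (-d ^ 2) := by positivity
    have hpβ : 0 < (p : ℝ) ^ (1 - β) := by positivity
    have h1 : c / 2 * (p : ℝ) ^ (-d ^ 2) ≤ gaussianTail (y * L - x * L) - Q := by
      have := mul_le_mul_of_nonneg_right hF2 hpd.le
      rw [← e1] at this
      linarith
    calc 4 * X = 16 * (p : ℝ) ^ (g - (1 - β - d ^ 2))
          * ((p : ℝ) ^ (1 - β) * (p : ℝ) ^ (-d ^ 2)) / 4 := by rw [e2]; ring
      _ ≤ c * ((p : ℝ) ^ (1 - β) * (p : ℝ) ^ (-d ^ 2)) / 4 := by gcongr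
      _ = (1 / 2 * (p : ℝ) ^ (1 - β)) * (c / 2 * (p : ℝ) ^ (-d ^ 2)) := by ring
      _ ≤ _ := mul_le_mul hsp h1 (by positivity) (Nat.cast_nonneg _)
  obtain ⟨T, hT, hcard, hTalt⟩ := exists_grid_mean_le (n := n p) hγ0 hγ1
  have key := minimaxError_le_of_scan (p := p) (n := n p) (s := s p)
    (ρ := √(2 * r * Real.log (p : ℝ))) (τ := y * L) (κ := p * Q + X)
    (B₁ := Real.exp (1 - l * X)) (B₂ := Real.exp (1 - l * X)) T (Real.exp_pos _).le
    (Real.exp_pos _).le (fun θ hθ t ht => ?_) (fun θ hθ => ?_)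
  · refine key.trans ?_
    rw [hlX, sub_eq_add_neg, Real.exp_add, Real.rpow_zero]
    have hcard' : (T.card : ℝ) ≤ 2 + (-Real.log γ)⁻¹ * (p : ℝ) ^ (2 * a) := by
      refine hcard.trans (add_le_add le_rfl ?_)
      rw [div_eq_inv_mul]
      exact mul_le_mul_of_nonneg_left hlog (inv_pos.2 hγl).le
    have hE : 0 ≤ Real.exp 1 * Real.exp (-(p : ℝ) ^ (g - h)) := by positivity
    exact (add_le_add_left (mul_le_mul_of_nonneg_right hcard' hE) _).trans_eq (by ring)
  · obtain ⟨h1, htn⟩ := hT t ht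
    exact law_real_exceedCount_ge_le_of_null (sum_contrast_mul_self h1 htn)
      (sum_contrast_mul_of_mem_nullSpace h1 htn hθ) hl0.le (by linarith) hlp
  · obtain ⟨t, ht, S, hS, hmem, hnot⟩ := hTalt p (s p) _ (Real.sqrt_nonneg _) θ hθ
    obtain ⟨h1, htn⟩ := hT t ht
    rw [hγ, div_sqrt_mul_sqrt hr] at hmem
    exact ⟨t, ht, law_real_exceedCount_lt_le_of_alt (sum_contrast_mul_self h1 htn) hS hmem hnot
      (by positivity) hl0.le hF4 hlp hX0.le hD⟩

lemma tendsto_minimaxError_of_one {a r : ℝ} {n s : ℕ → ℕ} (ha : 0 < a) (hra : 1 + a < r)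
    (hn : Tendsto (fun p : ℕ => Real.log (Real.log (n p : ℝ)) / (a * Real.log (p : ℝ)))
      atTop (𝓝 1))
    (hs : Tendsto (fun p : ℕ => (s p : ℝ) / (p : ℝ) ^ (1 - (1 : ℝ))) atTop (𝓝 1)) :
    Tendsto (fun p : ℕ => minimaxError p (n p) (√(2 * r * Real.log (p : ℝ))) (s p))
      atTop (𝓝 0) := by
  have hr : 0 < r := by linarith
  obtain ⟨y, hy1, hy2⟩ := exists_between (Real.sqrt_lt_sqrt (by linarith) hra)
  obtain ⟨x, hxy, hx⟩ := exists_between hy2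
  have hy0 : 0 < y := (Real.sqrt_nonneg _).trans_lt hy1
  have hx0 : 0 < x := hy0.trans hxy
  have hya : 1 + a < y ^ 2 := (Real.sqrt_lt' hy0).1 hy1
  obtain ⟨a', haa', ha'y⟩ := exists_between (by linarith : a < y ^ 2 - 1)
  have hsr : 0 < √r := hx0.trans hx
  set γ := x / √r with hγ
  have hγ0 : 0 < γ := div_pos hx0 hsr
  have hγ1 : γ < 1 := (div_lt_one hsr).2 hx
  have hγl : 0 < -Real.log γ := neg_pos.2 (Real.log_neg hγ0 hγ1)
  have hlim : Tendsto (fun p : ℕ => (2 * Real.exp 1) * (p : ℝ) ^ (1 - y ^ 2)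
      + (-Real.log γ)⁻¹ * Real.exp 1 * (p : ℝ) ^ (a' + (1 - y ^ 2))
      + 1 * (p : ℝ) ^ (-(x - y) ^ 2)) atTop (𝓝 0) := by
    have := ((tendsto_const_mul_rpow_zero (2 * Real.exp 1) (by linarith : 1 - y ^ 2 < 0)).add
      (tendsto_const_mul_rpow_zero ((-Real.log γ)⁻¹ * Real.exp 1)
        (by linarith : a' + (1 - y ^ 2) < 0))).add
      (tendsto_const_mul_rpow_zero 1 (neg_neg_of_pos (pow_pos (sub_pos.2 hxy) 2)))
    simpa only [add_zero] using this
  refine tendsto_of_tendsto_of_tendsto_of_le_of_le' tendsto_const_nhds hlim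
    (Eventually.of_forall fun p => minimaxError_nonneg _ _ _ _) ?_
  filter_upwards [eventually_log_le_rpow ha hn haa', eventually_sparsity_eq_one hs,
    eventually_gt_atTop 0] with p hlog hsp hp
  have hp0 : (0 : ℝ) < p := by exact_mod_cast hp
  set L := √(2 * Real.log (p : ℝ)) with hLdef
  have hL0 : 0 ≤ L := Real.sqrt_nonneg _
  obtain ⟨T, hT, hcard, hTalt⟩ := exists_grid_mean_le (n := n p) hγ0 hγ1
  have key := minimaxError_le_of_scan (p := p) (n := n p) (s := s p)
    (ρ := √(2 * r * Real.log (p : ℝ))) (τ := y * L) (κ := 1)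
    (B₁ := Real.exp 1 * (p : ℝ) ^ (1 - y ^ 2)) (B₂ := (p : ℝ) ^ (-(x - y) ^ 2)) T
    (by positivity) (by positivity) (fun θ hθ t ht => ?_) (fun θ hθ => ?_)
  · refine key.trans ?_
    have hcard' : (T.card : ℝ) ≤ 2 + (-Real.log γ)⁻¹ * (p : ℝ) ^ a' := by
      refine hcard.trans (add_le_add le_rfl ?_)
      rw [div_eq_inv_mul]
      exact mul_le_mul_of_nonneg_left hlog (inv_pos.2 hγl).le
    have hE : 0 ≤ Real.exp 1 * (p : ℝ) ^ (1 - y ^ 2) := by positivity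
    rw [Real.rpow_add hp0]
    exact (add_le_add_left (mul_le_mul_of_nonneg_right hcard' hE) _).trans_eq (by ring)
  · obtain ⟨h1, htn⟩ := hT t ht
    -- With e^l = p^(y²-1) the mean term is at most 1, so Chernoff recovers the first-moment bound
    -- p^(1-y²) up to a factor e.
    have hl : 0 ≤ (y ^ 2 - 1) * Real.log (p : ℝ) :=
      mul_nonneg (by linarith) (Real.log_natCast_nonneg p)
    refine (law_real_exceedCount_ge_le θ _ (sum_contrast_mul_self h1 htn) (y * L) 1 hl).trans ?_
    simp only [sum_contrast_mul_of_mem_nullSpace h1 htn hθ, sub_zero, Finset.sum_const,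
      Finset.card_univ, Fintype.card_fin, nsmul_eq_mul]
    rw [exp_mul_log_natCast hp, ← exp_mul_log_natCast hp (1 - y ^ 2), ← Real.exp_add]
    refine Real.exp_le_exp.2 ?_
    have hQle : gaussianTail (y * L) ≤ (p : ℝ) ^ (-y ^ 2) := by
      rw [← exp_neg_mul_sqrt_sq hp]
      exact gaussianTail_le (by positivity)
    have e : (p : ℝ) ^ (y ^ 2 - 1) * (p * (p : ℝ) ^ (-y ^ 2)) = 1 := by
      rw [mul_left_comm, ← Real.rpow_add hp0, ← sub_eq_add_neg, sub_right_comm, sub_self, zero_sub,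
        Real.rpow_neg_one, mul_inv_cancel₀ hp0.ne']
    have h2 : ((p : ℝ) ^ (y ^ 2 - 1) - 1) * (p * gaussianTail (y * L)) ≤ 1 := by
      have hQ0 := gaussianTail_nonneg (y * L)
      refine le_trans ?_ e.le
      refine mul_le_mul (by linarith) (mul_le_mul_of_nonneg_left hQle hp0.le) (by positivity)
        (by positivity)
    linarith
  · obtain ⟨t, ht, S, hS, hmem, -⟩ := hTalt p (s p) _ (Real.sqrt_nonneg _) θ hθ
    obtain ⟨h1, htn⟩ := hT t ht
    rw [hγ, div_sqrt_mul_sqrt hr] at hmem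
    rw [hsp] at hS
    obtain ⟨j, hj⟩ := Finset.card_pos.1 (Nat.succ_le_iff.1 hS)
    refine ⟨t, ht, ?_⟩
    rw [← exp_neg_mul_sqrt_sq hp, sub_mul]
    exact law_real_exceedCount_lt_one_le (sum_contrast_mul_self h1 htn)
      (mul_le_mul_of_nonneg_right hxy.le hL0) (hmem j hj)

/-- Above the detection boundary the minimax error tends to zero. -/
lemma tendsto_minimaxError_of_boundary_lt {a β r : ℝ} {n s : ℕ → ℕ} (ha : 0 < a)
    (hβ : 1 / 2 < β) (hβ1 : β ≤ 1) (hr : 0 < r) (hrb : boundary a β < r)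
    (hn : Tendsto (fun p : ℕ => Real.log (Real.log (n p : ℝ)) / (a * Real.log (p : ℝ)))
      atTop (𝓝 1))
    (hs : Tendsto (fun p : ℕ => (s p : ℝ) / (p : ℝ) ^ (1 - β)) atTop (𝓝 1)) :
    Tendsto (fun p : ℕ => minimaxError p (n p) (√(2 * r * Real.log (p : ℝ))) (s p))
      atTop (𝓝 0) := by
  rcases lt_or_ge β (3 / 4) with h34 | h34
  · have hrb' : β - 1 / 2 < r := by simpa [boundary, h34.le] using hrb
    have hβ0 : 0 < √(β - 1 / 2) := Real.sqrt_pos.2 (by linarith)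
    obtain ⟨x, hx1, hx2⟩ := exists_between (lt_min (Real.sqrt_lt_sqrt (by linarith) hrb')
      ((Real.sqrt_lt' one_half_pos).2 (by linarith) : √(β - 1 / 2) < 1 / 2))
    have hx0 := hβ0.trans hx1
    have hxβ := (Real.sqrt_lt' hx0).1 hx1
    have hxh := hx2.trans_le (min_le_right _ _)
    -- `y = 2x` maximises the gap of exponents, and the condition becomes x² > β - 1/2. It stays
    -- below 1 because x < 1/2.
    exact tendsto_minimaxError_of_exponents (x := x) (y := 2 * x) ha hr hx0
      (hx2.trans_le (min_le_left _ _)) (by linarith) (by nlinarith) (by linarith) hn hs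
  rcases lt_or_ge β 1 with h1 | h1
  · have hrb' : (1 - √(1 - β)) ^ 2 < r := by
      rcases h34.eq_or_lt with h | h
      -- At β = 3/4 both formulas for the boundary equal 1/4.
      · rw [← h] at hrb ⊢
        have : √(1 - 3 / 4 : ℝ) = 1 / 2 := by
          rw [show (1 - 3 / 4 : ℝ) = (1 / 2) ^ 2 by norm_num, Real.sqrt_sq (by norm_num)]
        rw [this]
        norm_num [boundary] at hrb ⊢
        exact hrb
      · simpa [boundary, not_le.2 h, h1] using hrb
    have hq0 : 0 < √(1 - β) := Real.sqrt_pos.2 (by linarith)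
    have hq1 : √(1 - β) < 1 := (Real.sqrt_lt' one_pos).2 (by linarith)
    have hqr : 1 - √(1 - β) < √r := Real.lt_sqrt (by linarith) |>.2 hrb'
    obtain ⟨x, hx1, hx2⟩ := exists_between (lt_min hqr (by linarith : 1 - √(1 - β) < 1))
    have hxr := hx2.trans_le (min_le_left _ _)
    have hxl := hx2.trans_le (min_le_right _ _)
    have hG : (1 - x) ^ 2 < 1 - β := by
      refine (Real.lt_sqrt (by linarith)).1 (by linarith)
    -- Here 2x would exceed 1, so y is taken just below 1, close enough that (1 - y²)/2 < 1 - y is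
    -- less than 1 - β - (1 - x)².
    obtain ⟨y, hy1, hy2⟩ := exists_between
      (max_lt hxl (by linarith : 1 - (1 - β - (1 - x) ^ 2) < 1))
    have hxy := (le_max_left _ _).trans_lt hy1
    have hyG := (le_max_right _ _).trans_lt hy1
    refine tendsto_minimaxError_of_exponents (x := x) (y := y) ha hr (by linarith) hxr hxy ?_
      hy2 hn hs
    have : (y - x) ^ 2 ≤ (1 - x) ^ 2 := pow_le_pow_left₀ (by linarith) (by linarith) 2
    nlinarith
  · have hβe : β = 1 := le_antisymm hβ1 h1
    subst hβe
    have hrb' : 1 + a < r := by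
      have h2 : boundary a 1 = 1 + a := by norm_num [boundary]
      rwa [h2] at hrb
    exact tendsto_minimaxError_of_one ha hrb' hn hs

end Changepoint

end

theorem theorem3 (a β r : ℝ) (ha : 0 < a) (hβ : 1 / 2 < β) (hβ1 : β ≤ 1) (hr : 0 < r)
    (n s : ℕ → ℕ)
    (hn : Tendsto (fun p : ℕ => Real.log (Real.log (n p : ℝ)) / (a * Real.log (p : ℝ)))
      atTop (𝓝 1))
    (hs : Tendsto (fun p : ℕ => (s p : ℝ) / (p : ℝ) ^ (1 - β)) atTop (𝓝 1)) :
    (r < Changepoint.boundary a β →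
      ¬ Tendsto (fun p : ℕ =>
          Changepoint.minimaxError p (n p) (Real.sqrt (2 * r * Real.log (p : ℝ))) (s p))
        atTop (𝓝 0)) ∧
    (Changepoint.boundary a β < r →
      Tendsto (fun p : ℕ =>
          Changepoint.minimaxError p (n p) (Real.sqrt (2 * r * Real.log (p : ℝ))) (s p))
        atTop (𝓝 0)) := by
  refine ⟨fun h hlim => ?_, fun h =>
    Changepoint.tendsto_minimaxError_of_boundary_lt ha hβ hβ1 hr h hn hs⟩
  have h1 := Changepoint.eventually_le_minimaxError_of_lt_boundary ha hβ hβ1 hr.le h hn hs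
  have h2 := ge_of_tendsto hlim h1
  norm_num at h2
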